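/- Let $G$ be a finite abelian group and let $G^\bullet$ be its set of nonzero elements. An indexed sequence $S$ over $G$ is an element of the free abelian monoid on $G^\bullet\times\mathbb N$ (the labels in $\mathbb N=\{0,1,2,\dots\}$ distinguish repeated terms); it is squarefree if no pair $(g,m)$ occurs in it more than once, and its sum is the sum of the $G$-components of its terms, counted with multiplicity. It is zero-sum if its sum is $0$, and irreducible if it is nonempty, zero-sum, and has no nonempty proper zero-sum subsequence. A unique factorization indexed sequence (UFIS) over $G$ is a squarefree zero-sum indexed sequence that can be written in exactly one way, up to the order of the factors, as a product of irreducible indexed sequences. The cross number of $S$ is the sum of $1/\mathrm{ord}(g)$ over its terms $(g,m)$. Put $$\mathsf K_1(G)=\max\{\mathsf k(S): S \text{ is a UFIS over } G\},$$ where $\mathsf k(S)$ is the cross number of $S$, and, if $G\cong\bigoplus_{i=1}^r C_{p_i^{\alpha_i}}$ with primes $p_i$ and $\alpha_i\ge 1$, $$\mathsf K_1^*(G)=\sum_{i=1}^r\frac{p_i^{\alpha_i}-1}{p_i^{\alpha_i}-p_i^{\alpha_i-1}}.$$ A positive integer $n=q_1^{\alpha_1}\cdots q_r^{\alpha_r}$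 with primes $q_1<\dots<q_r$ and $\alpha_j\ge1$ is called $2$-wide if for each $1\le i\le r-1$ $$\frac{q_i^2+2q_i-2}{q_i^2}\ \ge\ \prod_{j=i+1}^{r}\frac{q_j^{\alpha_j+1}-1}{q_j^{\alpha_j+1}-q_j^{\alpha_j}}.$$ **Theorem.** Let $n$ be a $2$-wide positive integer. Then the maximum defining $\mathsf K_1(C_n)$ exists and $\mathsf K_1(C_n)=\mathsf K_1^*(C_n)$. If moreover $n>1$ and $q$ is the largest prime dividing $n$, then the maximum defining $\mathsf K_1(C_n\oplus C_q)$ exists and $\mathsf K_1(C_n\oplus C_q)=\mathsf K_1^*(C_n\oplus C_q)$. -/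

import Mathlib

/-- An indexed sequence over the abelian group `G`: an element of the free abelian monoid over
`G• × ℕ`, where `G•` is the set of nonzero elements of `G`, written as a finite multiset.
Products of indexed sequences are sums of multisets, the identity sequence is `0`, and
divisibility `T ∣ S` is `T ≤ S`. -/
abbrev IndexedSeq (G : Type*) [AddCommGroup G] : Type _ :=
  Multiset ({g : G // g ≠ 0} × ℕ)

namespace IndexedSeq

/-- The sum of an indexed sequence. -/
def sigma {G : Type*} [AddCommGroup G] (S : IndexedSeq G) : G :=
  (S.map fun x => (x.1 : G)).sum

/-- An indexed sequence is squarefree if each indexed element occurs at most once. -/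
def IsSquarefree {G : Type*} [AddCommGroup G] (S : IndexedSeq G) : Prop :=
  S.Nodup

/-- The cross number: the sum of the inverse orders of the terms, with multiplicity. -/
noncomputable def crossNumber {G : Type*} [AddCommGroup G] (S : IndexedSeq G) : ℝ :=
  (S.map fun x => (1 : ℝ) / (addOrderOf (x.1 : G) : ℝ)).sum

/-- `S` is irreducible (minimal zero-sum): it is not the identity sequence, it is zero-sum, and
it has no nontrivial proper zero-sum subsequence. -/
def IsIrreducible {G : Type*} [AddCommGroup G] (S : IndexedSeq G) : Prop :=
  S ≠ 0 ∧ S.sigma = 0 ∧ ∀ T : IndexedSeq G, T ≤ S → T ≠ 0 → T.sigma = 0 → T = S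

/-- The factorization monoid of `G`: the free abelian monoid on the irreducible indexed
sequences over `G`. -/
abbrev FactorizationMonoid (G : Type*) [AddCommGroup G] : Type _ :=
  Multiset {S : IndexedSeq G // S.IsIrreducible}

/-- The homomorphism that multiplies out a formal product of irreducibles. -/
def factorizationProduct {G : Type*} [AddCommGroup G] (Z : FactorizationMonoid G) :
    IndexedSeq G :=
  (Z.map Subtype.val).sum

/-- A unique factorization indexed sequence (UFIS): a squarefree zero-sum indexed sequence with
exactly one irreducible factorization. -/
def IsUFIS {G : Type*} [AddCommGroup G] (S : IndexedSeq G) : Prop :=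
  S.IsSquarefree ∧ S.sigma = 0 ∧ ∃! Z : FactorizationMonoid G, factorizationProduct Z = S

end IndexedSeq

/-- The set of cross numbers of UFIS's over `G`. -/
def ufisCrossNumbers (G : Type*) [AddCommGroup G] : Set ℝ :=
  {x | ∃ S : IndexedSeq G, S.IsUFIS ∧ S.crossNumber = x}

/-- The constant `K₁(G)`: the maximal cross number of a UFIS over `G`. -/
noncomputable def crossK1 (G : Type*) [AddCommGroup G] : ℝ :=
  sSup (ufisCrossNumbers G)

/-- A decomposition of `G` as a direct sum of cyclic groups of prime power order `p i ^ a i`,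
`a i ≥ 1`. -/
structure PrimePowerDecomposition (G : Type*) [AddCommGroup G] where
  /-- the index set of the summands -/
  ι : Type
  /-- there are finitely many summands -/
  fin : Fintype ι
  /-- the primes -/
  p : ι → ℕ
  /-- the exponents -/
  a : ι → ℕ
  prime : ∀ i, (p i).Prime
  pos : ∀ i, 0 < a i
  /-- the isomorphism with the direct sum -/
  equiv : G ≃+ ((i : ι) → ZMod (p i ^ a i))

attribute [instance] PrimePowerDecomposition.fin

namespace PrimePowerDecomposition

/-- The sum of `(p^a - 1) / (p^a - p^(a-1))` over the summands of a decomposition. -/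
noncomputable def value {G : Type*} [AddCommGroup G] (D : PrimePowerDecomposition G) : ℝ :=
  ∑ i, ((D.p i : ℝ) ^ D.a i - 1) / ((D.p i : ℝ) ^ D.a i - (D.p i : ℝ) ^ (D.a i - 1))

theorem exists_decomposition (G : Type*) [AddCommGroup G] [Finite G] :
    Nonempty (PrimePowerDecomposition G) := by
  classical
  obtain ⟨ι, hι, p, hp, e, ⟨f⟩⟩ := AddCommGroup.equiv_directSum_zmod_of_finite G
  have hsub : ∀ i, ¬ 0 < e i → Subsingleton (ZMod (p i ^ e i)) := by
    intro i hi
    have h0 : e i = 0 := by omega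
    rw [h0, pow_zero]
    infer_instance
  let r : ((i : ι) → ZMod (p i ^ e i)) ≃+
      ((i : {i : ι // 0 < e i}) → ZMod (p i ^ e i)) :=
    { toFun := fun x i => x i
      invFun := fun y i => if h : 0 < e i then y ⟨i, h⟩ else 0
      left_inv := by
        intro x
        funext i
        by_cases h : 0 < e i
        · simp [h]
        · have := hsub i h
          exact Subsingleton.elim _ _
      right_inv := by
        intro y
        funext i
        simp [i.2]
      map_add' := fun _ _ => rfl }
  exact ⟨⟨{i : ι // 0 < e i}, inferInstance, fun i => p i, fun i => e i, fun i => hp i,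
    fun i => i.2, (f.trans (DirectSum.addEquivProd _)).trans r⟩⟩

theorem card_torsion {G : Type*} [AddCommGroup G] (D : PrimePowerDecomposition G) (m : ℕ) :
    Nat.card {g : G // m • g = 0} = ∏ i, (D.p i ^ D.a i).gcd m := by
  have hz : ∀ i, NeZero (D.p i ^ D.a i) := fun i => ⟨pow_ne_zero _ (D.prime i).ne_zero⟩
  let f : {g : G // m • g = 0} ≃ ((i : D.ι) → {x : ZMod (D.p i ^ D.a i) // m • x = 0}) :=
    (D.equiv.toEquiv.subtypeEquiv (q := fun y => ∀ i, m • y i = 0) (by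
      intro g
      have h : m • g = 0 ↔ D.equiv (m • g) = 0 := (map_eq_zero_iff D.equiv D.equiv.injective).symm
      rw [h, map_nsmul, funext_iff]
      rfl)).trans
      (Equiv.subtypePiEquivPi (p := fun i (x : ZMod (D.p i ^ D.a i)) => m • x = 0))
  rw [Nat.card_congr f, Nat.card_pi]
  refine Finset.prod_congr rfl fun i _ => ?_
  have h := IsAddCyclic.card_nsmulAddMonoidHom_ker (G := ZMod (D.p i ^ D.a i)) m
  rw [Nat.card_zmod] at h
  exact h

theorem factorization_card_torsion {G : Type*} [AddCommGroup G] (D : PrimePowerDecomposition G)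
    {l : ℕ} (hl : l.Prime) (k : ℕ) :
    (Nat.card {g : G // l ^ k • g = 0}).factorization l =
      ∑ i, if D.p i = l then min (D.a i) k else 0 := by
  have h := D.card_torsion (l ^ k)
  rw [h, Nat.factorization_prod fun i _ =>
    (Nat.gcd_pos_of_pos_right _ (pow_pos hl.pos k)).ne', Finsupp.finsetSum_apply]
  refine Finset.sum_congr rfl fun i _ => ?_
  rw [Nat.factorization_gcd (pow_ne_zero _ (D.prime i).ne_zero) (pow_ne_zero _ hl.ne_zero)]
  by_cases hpl : D.p i = l
  · subst hpl
    simp [hl.factorization]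
  · simp [hl.factorization, (D.prime i).factorization, hpl]

theorem card_filter_lt {G : Type*} [AddCommGroup G] (D : PrimePowerDecomposition G)
    {l : ℕ} (hl : l.Prime) (k : ℕ) :
    (∑ i, if D.p i = l ∧ k < D.a i then 1 else 0) +
      (Nat.card {g : G // l ^ k • g = 0}).factorization l =
      (Nat.card {g : G // l ^ (k + 1) • g = 0}).factorization l := by
  have h0 := D.factorization_card_torsion hl k
  have h1 := D.factorization_card_torsion hl (k + 1)
  rw [h0, h1, ← Finset.sum_add_distrib]
  refine Finset.sum_congr rfl fun i _ => ?_
  by_cases hp : D.p i = l <;> by_cases hk : k < D.a i <;> simp [hp, hk] <;> omega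

theorem term_eq_geom {p a : ℕ} (hp : p.Prime) (ha : 0 < a) :
    ((p : ℝ) ^ a - 1) / ((p : ℝ) ^ a - (p : ℝ) ^ (a - 1)) =
      ∑ k ∈ Finset.range a, ((p : ℝ) ^ k)⁻¹ := by
  have h1 : (1 : ℝ) < p := by exact_mod_cast hp.one_lt
  have h0 : (p : ℝ) ≠ 0 := by positivity
  have h2 : (p : ℝ) - 1 ≠ 0 := by linarith
  obtain ⟨b, rfl⟩ : ∃ b, a = b + 1 := ⟨a - 1, by omega⟩
  have hd : (p : ℝ) ^ (b + 1) - (p : ℝ) ^ (b + 1 - 1) = (p : ℝ) ^ b * (p - 1) := by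
    simp only [Nat.add_sub_cancel]; ring
  rw [hd]
  clear ha hd
  induction b with
  | zero => simp [h2]
  | succ b ih =>
    rw [Finset.sum_range_succ, ← ih]
    field_simp
    ring

theorem value_eq_of_bound {G : Type*} [AddCommGroup G] (D : PrimePowerDecomposition G)
    (B : ℕ) (hB : ∀ i, D.p i < B ∧ D.a i < B) :
    D.value = ∑ l ∈ (Finset.range B).filter Nat.Prime, ∑ k ∈ Finset.range B,
      (((Nat.card {g : G // l ^ (k + 1) • g = 0}).factorization l : ℝ) -
        ((Nat.card {g : G // l ^ k • g = 0}).factorization l : ℝ)) * ((l : ℝ) ^ k)⁻¹ := by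
  have hterm : ∀ l ∈ (Finset.range B).filter Nat.Prime, ∀ k ∈ Finset.range B,
      (((Nat.card {g : G // l ^ (k + 1) • g = 0}).factorization l : ℝ) -
        ((Nat.card {g : G // l ^ k • g = 0}).factorization l : ℝ)) * ((l : ℝ) ^ k)⁻¹ =
      ∑ i, if D.p i = l ∧ k < D.a i then ((l : ℝ) ^ k)⁻¹ else 0 := by
    intro l hl k _
    have h := D.card_filter_lt (Finset.mem_filter.1 hl).2 k
    rw [← h]
    push_cast
    rw [add_sub_cancel_right, Finset.sum_mul]
    refine Finset.sum_congr rfl fun i _ => ?_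
    split_ifs <;> simp
  rw [Finset.sum_congr rfl fun l hl => Finset.sum_congr rfl (hterm l hl)]
  rw [Finset.sum_congr rfl fun l _ => Finset.sum_comm, Finset.sum_comm]
  unfold value
  refine Finset.sum_congr rfl fun i _ => ?_
  rw [term_eq_geom (D.prime i) (D.pos i)]
  have hmem : D.p i ∈ (Finset.range B).filter Nat.Prime := by
    simp [D.prime i, (hB i).1]
  rw [Finset.sum_eq_single_of_mem (D.p i) hmem]
  · rw [← Finset.sum_filter]
    refine Finset.sum_congr ?_ fun _ _ => rfl
    ext k
    have := (hB i).2
    simp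
    omega
  · intro l _ hl
    exact Finset.sum_eq_zero fun k _ => if_neg fun h => hl h.1.symm

theorem value_eq_value {G : Type*} [AddCommGroup G] (D E : PrimePowerDecomposition G) :
    D.value = E.value := by
  let B := (∑ i, (D.p i + D.a i)) + (∑ i, (E.p i + E.a i)) + 1
  have hD : ∀ i, D.p i + D.a i ≤ ∑ i, (D.p i + D.a i) := fun i =>
    Finset.single_le_sum (f := fun i => D.p i + D.a i) (fun _ _ => Nat.zero_le _)
      (Finset.mem_univ i)
  have hE : ∀ i, E.p i + E.a i ≤ ∑ i, (E.p i + E.a i) := fun i =>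
    Finset.single_le_sum (f := fun i => E.p i + E.a i) (fun _ _ => Nat.zero_le _)
      (Finset.mem_univ i)
  rw [D.value_eq_of_bound B fun i => by have := hD i; constructor <;> simp only [B] <;> omega,
    E.value_eq_of_bound B fun i => by have := hE i; constructor <;> simp only [B] <;> omega]

end PrimePowerDecomposition

/-- The constant `K₁*(G)`: the sum of `(p^a - 1) / (p^a - p^(a-1))` over the summands of a
decomposition of the finite abelian group `G` into cyclic groups of prime power order `p^a`. -/
noncomputable def crossK1Star (G : Type*) [AddCommGroup G] [Finite G] : ℝ :=
  (Classical.choice (PrimePowerDecomposition.exists_decomposition G)).value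

/-- `K₁*(G)` does not depend on the decomposition. -/
theorem crossK1Star_eq_value {G : Type*} [AddCommGroup G] [Finite G]
    (D : PrimePowerDecomposition G) : crossK1Star G = D.value :=
  PrimePowerDecomposition.value_eq_value _ _

/-- The prime `p` is 2-wide with respect to the positive integer `n`. -/
def TwoWideWrt (p n : ℕ) : Prop :=
  p.Prime ∧ ¬ p ∣ n ∧
    ∏ q ∈ n.primeFactors,
      ((q : ℝ) ^ (n.factorization q + 1) - 1) /
        ((q : ℝ) ^ (n.factorization q + 1) - (q : ℝ) ^ n.factorization q) ≤
      ((p : ℝ) ^ 2 + 2 * (p : ℝ) - 2) / (p : ℝ) ^ 2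

/-- The positive integer `n` is 2-wide: every prime factor `p` of `n` other than the largest is
2-wide with respect to the part of `n` composed of the prime factors greater than `p`. -/
def TwoWide (n : ℕ) : Prop :=
  0 < n ∧ ∀ p ∈ n.primeFactors, (∃ q ∈ n.primeFactors, p < q) →
    TwoWideWrt p (∏ q ∈ n.primeFactors with p < q, q ^ n.factorization q)

/-- `q = P⁺(n)`: `q` is the largest prime dividing `n`. -/
def IsLargestPrimeFactor (q n : ℕ) : Prop :=
  IsGreatest {p : ℕ | p.Prime ∧ p ∣ n} q

/-!
Unique factorization is a statement about zero-sum subsets: a squarefree zero-sum indexed sequence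
is a UFIS if and only if its zero-sum subsets are closed under intersection (`IsUniquelyZeroSum`).
This property survives three operations: several terms may be merged into their sum if that is
nonzero (`IsUniquelyZeroSum.merge`), a group of terms may be collapsed into at most one term
(`IsUniquelyZeroSum.collapse`), and terms that cover a subgroup by their subset sums may be divided
out together with it (`IsUniquelyZeroSum.quotient`). Moreover each term has a partner that
accompanies it in all zero-sum subsets (`IsUniquelyZeroSum.exists_partner`), so that subset sums
cannot cover too much.

The upper bound adds the primes dividing `n` in decreasing order
(`sum_invOrder_le_of_prod_cyclic`). In `G ⊕ C_{p ^ α}` with the exponent `E` of `G` coprime to `p`,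
merging as long as the cross number does not drop leads to a sequence with at most `p` terms of
each order `d * p ^ l`, `l ≥ 1` (`IsUniquelyZeroSum.card_le_of_reduced`). If for each `l` at least
`p - 1` terms have order exactly `p ^ l`, they cover `C_{p ^ α}` and the rest descends to `G`.
Otherwise, take a level with at most `p - 2` such terms and collapse all terms from this level on.
The loss of two terms at that level compensates for the terms of the orders `d * p ^ l` with
`d > 1` as soon as `∑_{d ∣ E} 1 / d ≤ 1 + 2 * (p - 1) / p ^ 2`, which is the 2-wide condition,
since the product in its definition is the sum of the inverse divisors
(`prod_primeFactors_eq_sum_inv_divisors`).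

The induction starts at the trivial group for `C_n`, and at `C_{q ^ a} ⊕ C_q` for `C_n ⊕ C_q`
(`CrossNumberBound.cyclic_prod_prime`). The latter case reduces to the claim that over the plane
`C_q ⊕ C_q` there are at most `2 * q` terms (`IsUniquelyZeroSum.card_le_two_mul`). That needs a
covering theorem: `2 * q - 1` nonzero vectors, fewer than `q` on each line through the origin, have
all vectors as subset sums (`exists_subset_sum_eq_of_card_line_lt`). In the group ring of the
plane, which is a truncated polynomial ring, it suffices that for some `2 * q - 2` of the vectors
the product of the associated linear forms has a nonzero middle coefficient. Failing this, a
minimal subproduct lying in the ideal `(X ^ q, Y ^ q)` would be a polynomial with a long gap in its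
coefficients and few distinct roots, and a Wronskian argument excludes that
(`IsFrobeniusNull.card_roots_le`).

The lower bound comes from explicit blocks of `p` terms of order `p ^ k`, one block for each
`1 ≤ k ≤ α` and each cyclic summand of order `p ^ α`
(`PrimePowerDecomposition.value_mem_ufisCrossNumbers`).
-/

open Finset

/-! ### Uniquely zero-sum families -/

/-- The family `g` restricted to `s` is a *uniquely zero-sum family*: its terms are nonzero, its
sum is zero, and the zero-sum subsets of `s` are closed under intersection. For indexed sequences
this is equivalent to unique factorization into irreducibles
(`IndexedSeq.IsUFIS.isUniquelyZeroSum`, `IndexedSeq.isUFIS_of_isUniquelyZeroSum`). The labels of an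
indexed sequence are replaced by the index type `ι`, so that repeated values of `g` are allowed. -/
structure IsUniquelyZeroSum {ι G : Type*} [DecidableEq ι] [AddCommGroup G]
    (s : Finset ι) (g : ι → G) : Prop where
  ne_zero : ∀ i ∈ s, g i ≠ 0
  sum_eq_zero : ∑ i ∈ s, g i = 0
  sum_inter : ∀ t ⊆ s, ∀ u ⊆ s, ∑ i ∈ t, g i = 0 → ∑ i ∈ u, g i = 0 → ∑ i ∈ t ∩ u, g i = 0

theorem sum_update_insert_sdiff {ι G : Type*} [DecidableEq ι] {s T : Finset ι} {a : ι} (ha : a ∈ T)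
    (g : ι → G) (w : G → ℝ) (x : G) :
    ∑ i ∈ insert a (s \ T), w (Function.update g a x i) = w x + ∑ i ∈ s \ T, w (g i) := by
  rw [sum_insert (by simp [ha]), Function.update_self]
  congr 1
  refine sum_congr rfl fun i hi => ?_
  rw [Function.update_of_ne]
  rintro rfl
  exact (mem_sdiff.1 hi).2 ha

namespace IsUniquelyZeroSum

variable {ι κ G H : Type*} [DecidableEq ι] [DecidableEq κ] [AddCommGroup G] [AddCommGroup H]
  {s : Finset ι} {g : ι → G}

theorem congr (h : IsUniquelyZeroSum s g) {g' : ι → G} (hg : ∀ i ∈ s, g' i = g i) :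
    IsUniquelyZeroSum s g' := by
  have key : ∀ t ⊆ s, ∑ i ∈ t, g' i = ∑ i ∈ t, g i := fun t ht =>
    sum_congr rfl fun i hi => hg i (ht hi)
  refine ⟨fun i hi => by rw [hg i hi]; exact h.ne_zero i hi,
    by rw [key s Subset.rfl, h.sum_eq_zero],
    fun t ht u hu h1 h2 => ?_⟩
  rw [key _ ht] at h1
  rw [key _ hu] at h2
  rw [key _ (inter_subset_left.trans ht)]
  exact h.sum_inter t ht u hu h1 h2

theorem subset (h : IsUniquelyZeroSum s g) {t : Finset ι} (hts : t ⊆ s)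
    (ht : ∑ i ∈ t, g i = 0) : IsUniquelyZeroSum t g :=
  ⟨fun i hi => h.ne_zero i (hts hi), ht,
    fun u hu v hv => h.sum_inter u (hu.trans hts) v (hv.trans hts)⟩

/-- A homomorphism that creates no new zero-sum subsets preserves uniquely zero-sum families. -/
theorem map (h : IsUniquelyZeroSum s g) (π : G →+ H)
    (hπ : ∀ t ⊆ s, π (∑ i ∈ t, g i) = 0 → ∑ i ∈ t, g i = 0) :
    IsUniquelyZeroSum s (fun i => π (g i)) := by
  refine ⟨fun i hi h0 => h.ne_zero i hi ?_, by rw [← map_sum, h.sum_eq_zero, map_zero],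
    fun t ht u hu h1 h2 => ?_⟩
  · simpa using hπ {i} (by simpa using hi) (by simpa using h0)
  · rw [← map_sum] at h1 h2 ⊢
    rw [h.sum_inter t ht u hu (hπ t ht h1) (hπ u hu h2), map_zero]

/-- Grouping the terms along a map `f` and adding up each group preserves uniquely zero-sum
families, as long as no group has sum zero: zero-sum sets of groups correspond to zero-sum unions
of groups. -/
theorem fiber (h : IsUniquelyZeroSum s g) (f : ι → κ)
    (hf : ∀ j ∈ s.image f, ∑ i ∈ s with f i = j, g i ≠ 0) :
    IsUniquelyZeroSum (s.image f) (fun j => ∑ i ∈ s with f i = j, g i) := by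
  have key : ∀ t ⊆ s.image f, ∑ j ∈ t, ∑ i ∈ s with f i = j, g i = ∑ i ∈ s with f i ∈ t, g i := by
    intro t _
    rw [← sum_fiberwise_of_maps_to (s := s.filter fun i => f i ∈ t) (t := t) (g := f)
      (fun i hi => (mem_filter.1 hi).2)]
    refine sum_congr rfl fun j hj => sum_congr ?_ fun _ _ => rfl
    ext i
    simp only [mem_filter]
    grind
  refine ⟨hf, ?_, fun t ht u hu h1 h2 => ?_⟩
  · rw [key _ Subset.rfl, filter_true_of_mem fun i hi => mem_image_of_mem f hi, h.sum_eq_zero]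
  · rw [key _ ht] at h1
    rw [key _ hu] at h2
    rw [key _ (inter_subset_left.trans ht)]
    have := h.sum_inter _ (filter_subset _ _) _ (filter_subset _ _) h1 h2
    rw [← this]
    refine sum_congr ?_ fun _ _ => rfl
    ext i
    simp only [mem_filter, mem_inter]
    tauto

/-- The terms indexed by `T` may be replaced by the single term `∑ i ∈ T, g i`, stored at an index
`a ∈ T`, provided that it is nonzero. -/
theorem merge (h : IsUniquelyZeroSum s g) {T : Finset ι} (hT : T ⊆ s) {a : ι} (ha : a ∈ T)
    (hne : ∑ i ∈ T, g i ≠ 0) :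
    IsUniquelyZeroSum (insert a (s \ T)) (Function.update g a (∑ i ∈ T, g i)) := by
  let f : ι → ι := fun i => if i ∈ T then a else i
  have himg : s.image f = insert a (s \ T) := by
    ext j
    simp only [mem_image, mem_insert, mem_sdiff, f]
    constructor
    · rintro ⟨i, hi, rfl⟩
      split_ifs with hiT
      · exact Or.inl rfl
      · exact Or.inr ⟨hi, hiT⟩
    · rintro (rfl | ⟨hj, hjT⟩)
      · exact ⟨j, hT ha, by simp [ha]⟩
      · exact ⟨j, hj, by simp [hjT]⟩
  have hfa : ∑ i ∈ s with f i = a, g i = ∑ i ∈ T, g i := by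
    refine sum_congr ?_ fun _ _ => rfl
    ext i
    simp only [mem_filter, f]
    constructor
    · rintro ⟨_, hi⟩
      by_contra hiT
      rw [if_neg hiT] at hi
      exact hiT (hi ▸ ha)
    · intro hi
      exact ⟨hT hi, if_pos hi⟩
  have hfj : ∀ j ∈ s \ T, ∑ i ∈ s with f i = j, g i = g j := by
    intro j hj
    rw [mem_sdiff] at hj
    rw [← sum_singleton g j]
    refine sum_congr ?_ fun _ _ => rfl
    ext i
    simp only [mem_filter, mem_singleton, f]
    constructor
    · rintro ⟨_, hi⟩
      split_ifs at hi with hiT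
      · exact absurd (hi ▸ ha) hj.2
      · exact hi
    · rintro rfl
      exact ⟨hj.1, if_neg hj.2⟩
  have hfib := h.fiber f (by
    rw [himg]
    intro j hj
    rcases mem_insert.1 hj with rfl | hj
    · rwa [hfa]
    · rw [hfj j hj]
      exact h.ne_zero j (mem_sdiff.1 hj).1)
  rw [himg] at hfib
  refine hfib.congr fun j hj => ?_
  rcases mem_insert.1 hj with rfl | hj
  · rw [Function.update_self, hfa]
  · rw [hfj j hj, Function.update_of_ne]
    intro hja
    exact (mem_sdiff.1 hj).2 (hja ▸ ha)

/-- If the terms outside `A` lie in a subgroup `M`, merging `A` into one term (or dropping it, when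
its sum is zero) gives a family in `M`, since the sum over `A` is minus the sum of the rest. The
total of a nonnegative weight over the complement of `A` does not decrease. -/
theorem collapse (h : IsUniquelyZeroSum s g) {A : Finset ι} (hA : A ⊆ s) (M : AddSubgroup G)
    (hM : ∀ i ∈ s \ A, g i ∈ M) (w : G → ℝ) (hw : ∀ x, 0 ≤ w x) :
    ∃ (s' : Finset ι) (g' : ι → G), IsUniquelyZeroSum s' g' ∧ (∀ i ∈ s', g' i ∈ M) ∧
      ∑ i ∈ s \ A, w (g i) ≤ ∑ i ∈ s', w (g' i) := by
  have hsum : ∑ i ∈ s \ A, g i + ∑ i ∈ A, g i = 0 := by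
    rw [sum_sdiff hA, h.sum_eq_zero]
  by_cases h0 : ∑ i ∈ A, g i = 0
  · exact ⟨s \ A, g, h.subset sdiff_subset (by simpa [h0] using hsum), hM, le_rfl⟩
  · obtain ⟨a, ha⟩ : A.Nonempty := by
      rw [nonempty_iff_ne_empty]
      rintro rfl
      simp at h0
    refine ⟨_, _, h.merge hA ha h0, fun i hi => ?_, ?_⟩
    · rcases mem_insert.1 hi with rfl | hi
      · rw [Function.update_self, ← neg_eq_of_add_eq_zero_right hsum]
        exact M.neg_mem (M.sum_mem hM)
      · rw [Function.update_of_ne]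
        · exact hM i hi
        · intro hia
          exact (mem_sdiff.1 hi).2 (hia ▸ ha)
    · rw [sum_update_insert_sdiff ha]
      linarith [hw (∑ i ∈ A, g i)]

/-- If the terms killed by `π` have enough subset sums to complete every subset whose image has sum
zero to a zero-sum subset, then the images of the remaining terms form a uniquely zero-sum family
in the target of `π`. -/
theorem quotient (h : IsUniquelyZeroSum s g) (π : G →+ H) [DecidableEq H]
    (hcov : ∀ U ⊆ s, ∑ i ∈ U, π (g i) = 0 →
      ∃ V ⊆ s.filter (fun i => π (g i) = 0), ∑ i ∈ V, g i = - ∑ i ∈ U, g i) :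
    IsUniquelyZeroSum (s.filter fun i => ¬ π (g i) = 0) (fun i => π (g i)) := by
  have hsub : ∀ t ⊆ s.filter (fun i => ¬ π (g i) = 0), ∀ V ⊆ s.filter (fun i => π (g i) = 0),
      Disjoint t V := fun t ht V hV =>
    (disjoint_filter_filter_not s s _).symm.mono ht hV
  refine ⟨fun i hi => (mem_filter.1 hi).2, ?_, fun t ht u hu h1 h2 => ?_⟩
  · have := congrArg π h.sum_eq_zero
    rw [map_sum, map_zero] at this
    rw [← sum_filter_add_sum_filter_not s (fun i => π (g i) = 0),
      Finset.sum_eq_zero (s := s.filter fun i => π (g i) = 0) fun i hi => (mem_filter.1 hi).2,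
      zero_add] at this
    exact this
  · -- Intersecting the completed sets `t ∪ V` and `u ∪ W` gives `(t ∩ u) ∪ (V ∩ W)`, and `π`
    -- kills the terms of `V ∩ W`.
    obtain ⟨V, hV, hVs⟩ := hcov t (ht.trans (filter_subset _ _)) h1
    obtain ⟨W, hW, hWs⟩ := hcov u (hu.trans (filter_subset _ _)) h2
    have key := h.sum_inter (t ∪ V)
      (union_subset (ht.trans (filter_subset _ _)) (hV.trans (filter_subset _ _))) (u ∪ W)
      (union_subset (hu.trans (filter_subset _ _)) (hW.trans (filter_subset _ _)))
      (by rw [sum_union (hsub t ht V hV), hVs, add_neg_cancel])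
      (by rw [sum_union (hsub u hu W hW), hWs, add_neg_cancel])
    have hset : (t ∪ V) ∩ (u ∪ W) = (t ∩ u) ∪ (V ∩ W) := by
      have h3 := hsub t ht W hW
      have h4 := hsub u hu V hV
      rw [disjoint_left] at h3 h4
      ext i
      simp only [mem_inter, mem_union]
      grind
    rw [hset, sum_union (hsub _ (inter_subset_left.trans ht) _ (inter_subset_left.trans hV))] at key
    have := congrArg π key
    rw [map_add, map_sum, map_sum, map_zero, Finset.sum_eq_zero (s := V ∩ W) fun i hi =>
      (mem_filter.1 (hV (mem_inter.1 hi).1)).2, add_zero] at this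
    exact this

/-- Every index `u` has a partner `v` that lies in all zero-sum subsets containing `u`: the
smallest zero-sum subset containing `u` is not `{u}`, as the terms are nonzero. -/
theorem exists_partner (h : IsUniquelyZeroSum s g) {u : ι} (hu : u ∈ s) :
    ∃ v, v ≠ u ∧ ∀ t ⊆ s, ∑ i ∈ t, g i = 0 → u ∈ t → v ∈ t := by
  classical
  obtain ⟨B, hB, hmin⟩ := exists_min_image
    (s.powerset.filter fun t => ∑ i ∈ t, g i = 0 ∧ u ∈ t) card
    ⟨s, by simp [h.sum_eq_zero, hu]⟩
  simp only [mem_filter, mem_powerset] at hB hmin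
  have hBt : ∀ t ⊆ s, ∑ i ∈ t, g i = 0 → u ∈ t → B ⊆ t := by
    intro t ht h0 hut
    have := hmin (B ∩ t) ⟨inter_subset_left.trans hB.1, h.sum_inter B hB.1 t ht hB.2.1 h0,
      mem_inter.2 ⟨hB.2.2, hut⟩⟩
    rw [← eq_of_subset_of_card_le inter_subset_left this]
    exact inter_subset_right
  obtain ⟨v, hv, hvu⟩ : ∃ v ∈ B, v ≠ u := by
    by_contra! hcon
    have : B = {u} := by
      ext i
      simp only [mem_singleton]
      exact ⟨hcon i, fun hi => hi ▸ hB.2.2⟩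
    have h0 := hB.2.1
    rw [this, sum_singleton] at h0
    exact h.ne_zero u hu h0
  exact ⟨v, hvu, fun t ht h0 hut => hBt t ht h0 hut hv⟩

end IsUniquelyZeroSum

/-! ### Subset sums in groups of prime order -/

/-- In a group of prime order `p`, any `p - 1` nonzero terms have every element as a subset sum:
each new term enlarges the set of subset sums until it is the whole group. -/
theorem exists_subset_sum_eq_of_card_prime {ι H : Type*} [AddCommGroup H] {p : ℕ}
    (hp : p.Prime) (hcard : Nat.card H = p) (s : Finset ι) (f : ι → H) (hf : ∀ i ∈ s, f i ≠ 0)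
    (hs : p ≤ s.card + 1) (c : H) : ∃ t ⊆ s, ∑ i ∈ t, f i = c := by
  classical
  have : Finite H := Nat.finite_of_card_ne_zero (hcard ▸ hp.ne_zero)
  have : Fintype H := Fintype.ofFinite H
  have hfact : Fact p.Prime := ⟨hp⟩
  have hu : (univ : Finset H).card = p := by rw [← hcard, Nat.card_eq_fintype_card]; rfl
  have key : ∀ s : Finset ι, (∀ i ∈ s, f i ≠ 0) →
      min p (s.card + 1) ≤ (s.powerset.image fun t => ∑ i ∈ t, f i).card := by
    intro s
    induction s using Finset.induction_on with
    | empty => simp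
    | insert a s ha ih =>
      intro hf
      have ih := ih fun i hi => hf i (mem_insert_of_mem hi)
      set X := s.powerset.image fun t => ∑ i ∈ t, f i with hX
      set Y := (insert a s).powerset.image fun t => ∑ i ∈ t, f i with hY
      have hXY : X ⊆ Y := image_subset_image (powerset_mono.2 (subset_insert a s))
      rw [card_insert_of_notMem ha]
      by_cases hlt : X.card < Y.card
      · have : min p (s.card + 1 + 1) ≤ min p (s.card + 1) + 1 := by omega
        omega
      · -- If the new term `f a` adds nothing, `X` is stable under adding `f a`, a generator of `H`.
        have hEq : X = Y := eq_of_subset_of_card_le hXY (not_lt.1 hlt)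
        have hadd : ∀ x ∈ X, f a + x ∈ X := by
          intro x hx
          rw [hEq]
          obtain ⟨t, ht, rfl⟩ := mem_image.1 hx
          rw [mem_powerset] at ht
          refine mem_image.2 ⟨insert a t, mem_powerset.2 (insert_subset_insert a ht), ?_⟩
          rw [sum_insert fun h => ha (ht h)]
        have hn : ∀ n : ℕ, n • f a ∈ X := by
          intro n
          induction n with
          | zero => exact mem_image.2 ⟨∅, by simp, by simp⟩
          | succ n ihn => rw [succ_nsmul']; exact hadd _ ihn
        have hall : Y = univ := by
          rw [← hEq]
          refine eq_univ_of_forall fun x => ?_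
          obtain ⟨n, rfl⟩ : x ∈ AddSubmonoid.multiples (f a) :=
            mem_multiples_of_prime_card hcard (hf a (mem_insert_self a s))
          exact hn n
        rw [hall, hu]
        exact min_le_left _ _
  have h1 := key s hf
  rw [min_eq_left hs] at h1
  have h2 : (s.powerset.image fun t => ∑ i ∈ t, f i) = univ :=
    eq_univ_of_card _ (le_antisymm (card_le_univ _) (by rwa [← card_univ, hu]))
  obtain ⟨t, ht, h3⟩ := mem_image.1 (h2 ▸ mem_univ c)
  exact ⟨t, mem_powerset.1 ht, h3⟩

theorem AddSubgroup.exists_subset_sum_eq {ι H : Type*} [AddCommGroup H] {p : ℕ}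
    (hp : p.Prime) (K : AddSubgroup H) (hcard : Nat.card K = p) (s : Finset ι) (f : ι → H)
    (hK : ∀ i ∈ s, f i ∈ K) (hf : ∀ i ∈ s, f i ≠ 0) (hs : p ≤ s.card + 1) {c : H} (hc : c ∈ K) :
    ∃ t ⊆ s, ∑ i ∈ t, f i = c := by
  classical
  let f' : ι → K := fun i => if h : f i ∈ K then ⟨f i, h⟩ else 0
  have hf' : ∀ i ∈ s, (f' i : H) = f i := fun i hi => by simp [f', hK i hi]
  obtain ⟨t, ht, hsum⟩ := exists_subset_sum_eq_of_card_prime hp hcard s f'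
    (fun i hi h0 => hf i hi (by rw [← hf' i hi, h0]; rfl)) hs ⟨c, hc⟩
  refine ⟨t, ht, ?_⟩
  rw [← sum_congr rfl fun i hi => hf' i (ht hi)]
  simpa using congrArg (Subtype.val) hsum

section

open Polynomial

/-! ### Polynomials with a gap in their coefficients -/

/-- The coefficients of `f` at the exponents `i` with `d - p < i < p` vanish. If `f` has degree at
most `d` and is viewed as a binary form of degree `d` in `X` and `Y`, this says that the form lies
in the ideal `(X ^ p, Y ^ p)`. The second inequality is written `d < i + p` to avoid subtraction.
-/
def IsFrobeniusNull (p d : ℕ) {K : Type*} [Semiring K] (f : K[X]) : Prop :=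
  ∀ i < p, d < i + p → f.coeff i = 0

theorem coeff_linear_mul_succ {K : Type*} [CommRing K] (a b : K) (f : K[X]) (i : ℕ) :
    ((C a * X + C b) * f).coeff (i + 1) = a * f.coeff i + b * f.coeff (i + 1) := by
  rw [add_mul, coeff_add, mul_assoc, coeff_C_mul, coeff_C_mul, coeff_X_mul]

theorem coeff_linear_mul_zero {K : Type*} [CommRing K] (a b : K) (f : K[X]) :
    ((C a * X + C b) * f).coeff 0 = b * f.coeff 0 := by
  simp [mul_coeff_zero]

theorem IsFrobeniusNull.linear_mul {p d : ℕ} {K : Type*} [CommRing K] {f : K[X]}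
    (h : IsFrobeniusNull p d f) (a b : K) :
    IsFrobeniusNull p (d + 1) ((C a * X + C b) * f) := by
  intro i hi hd
  cases i with
  | zero => rw [coeff_linear_mul_zero, h 0 hi (by omega), mul_zero]
  | succ i =>
    rw [coeff_linear_mul_succ, h i (by omega) (by omega), h (i + 1) hi (by omega)]
    ring

/-- The socle of `K[X, Y] / (X ^ p, Y ^ p)` is concentrated in degree `2 * p - 2`: a form of
smaller degree that is killed modulo `(X ^ p, Y ^ p)` by two independent linear forms is itself
zero there. -/
theorem IsFrobeniusNull.of_linear_mul {p d : ℕ} {K : Type*} [Field K] {f : K[X]}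
    (hd : d + 2 < 2 * p) {a b a' b' : K} (hdet : a * b' - a' * b ≠ 0)
    (h : IsFrobeniusNull p (d + 1) ((C a * X + C b) * f))
    (h' : IsFrobeniusNull p (d + 1) ((C a' * X + C b') * f)) : IsFrobeniusNull p d f := by
  intro i hi hdi
  by_cases hlt : d + 1 < i + p
  · have h1 := h i hi hlt
    have h2 := h' i hi hlt
    have : (a * b' - a' * b) * f.coeff i = 0 := by
      cases i with
      | zero =>
        rw [coeff_linear_mul_zero] at h1 h2
        linear_combination a * h2 - a' * h1
      | succ i =>
        rw [coeff_linear_mul_succ] at h1 h2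
        linear_combination a * h2 - a' * h1
    exact (mul_eq_zero.1 this).resolve_left hdet
  · have h1 := h (i + 1) (by omega) (by omega)
    have h2 := h' (i + 1) (by omega) (by omega)
    rw [coeff_linear_mul_succ] at h1 h2
    have : (a * b' - a' * b) * f.coeff i = 0 := by linear_combination b' * h1 - b * h2
    exact (mul_eq_zero.1 this).resolve_left hdet

/-- The Wronskian of `q` and `f` is divisible by `f` divided by its radical, which bounds the
number of distinct roots of a split polynomial `f` from below. -/
theorem natDegree_le_natDegree_wronskian_add {K : Type*} [Field K] [DecidableEq K] {f : K[X]}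
    (hs : f.Splits) (hf : f ≠ 0) (q : K[X]) (hw : wronskian q f ≠ 0) :
    f.natDegree ≤ (wronskian q f).natDegree + f.roots.toFinset.card := by
  have hdvd : f ∣ wronskian q f * ∏ r ∈ f.roots.toFinset, (X - C r) := by
    have h1 : f = C f.leadingCoeff * ∏ r ∈ f.roots.toFinset, (X - C r) ^ f.rootMultiplicity r := by
      conv_lhs => rw [hs.eq_prod_roots, Finset.prod_multiset_map_count]
      simp only [count_roots]
    have h2 : ∏ r ∈ f.roots.toFinset, (X - C r) ^ f.rootMultiplicity r ∣
        wronskian q f * ∏ r ∈ f.roots.toFinset, (X - C r) := by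
      refine Finset.prod_dvd_of_coprime (fun r _ r' _ hrr => ?_) fun r hr => ?_
      · exact ((pairwise_coprime_X_sub_C (s := (id : K → K)) Function.injective_id) hrr).pow
      · have hm : 0 < f.rootMultiplicity r := by
          rw [rootMultiplicity_pos hf]
          exact (mem_roots hf).1 (Multiset.mem_toFinset.1 hr)
        have h3 : (X - C r) ^ (f.rootMultiplicity r - 1) ∣ wronskian q f := by
          have h4 : (X - C r) ^ (f.rootMultiplicity r - 1) ∣ derivative f :=
            pow_sub_one_dvd_derivative_of_pow_dvd (f.pow_rootMultiplicity_dvd r)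
          have h5 : (X - C r) ^ (f.rootMultiplicity r - 1) ∣ f :=
            (pow_dvd_pow _ (Nat.sub_le _ _)).trans (f.pow_rootMultiplicity_dvd r)
          exact dvd_sub (h4.mul_left _) (h5.mul_left _)
        rw [← Nat.sub_add_cancel hm, pow_succ]
        exact mul_dvd_mul h3 (Finset.dvd_prod_of_mem _ hr)
    have hlc : f.leadingCoeff ≠ 0 := leadingCoeff_ne_zero.2 hf
    conv_lhs => rw [h1]
    exact ((isUnit_C.2 hlc.isUnit).mul_left_dvd).2 h2
  have hprod : (∏ r ∈ f.roots.toFinset, (X - C r)) ≠ 0 :=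
    Finset.prod_ne_zero_iff.2 fun r _ => X_sub_C_ne_zero r
  refine (natDegree_le_of_dvd hdvd (mul_ne_zero hw hprod)).trans ?_
  rw [natDegree_mul hw hprod, natDegree_prod_of_monic _ _ fun r _ => monic_X_sub_C r]
  simp

/-- If the Wronskian vanishes, then, after removal of a common factor with `q`, the polynomial `f`
is a `p`-th power over `ZMod p`, so that it has a root of multiplicity at least `p`. -/
theorem exists_rootMultiplicity_of_wronskian_eq_zero {p : ℕ} [Fact p.Prime] {f q : (ZMod p)[X]}
    (hs : f.Splits) (hf : f ≠ 0) (hq : q ≠ 0)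
    (hdeg : q.natDegree < f.natDegree) (hw : wronskian q f = 0) :
    ∃ r, p ≤ f.rootMultiplicity r := by
  classical
  obtain ⟨q1, hq1⟩ := EuclideanDomain.gcd_dvd_left q f
  obtain ⟨f1, hf1⟩ := EuclideanDomain.gcd_dvd_right q f
  set c := EuclideanDomain.gcd q f with hc
  have hc0 : c ≠ 0 := by
    intro h0
    rw [h0, zero_mul] at hf1
    exact hf hf1
  have hcop : IsCoprime q1 f1 := by
    have hb := EuclideanDomain.gcd_eq_gcd_ab q f
    refine ⟨EuclideanDomain.gcdA q f, EuclideanDomain.gcdB q f, mul_left_cancel₀ hc0 ?_⟩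
    rw [← hc] at hb
    linear_combination -hb - hq1 * EuclideanDomain.gcdA q f - hf1 * EuclideanDomain.gcdB q f
  have hw1 : c ^ 2 * wronskian q1 f1 = 0 := by
    rw [← hw]
    conv_rhs => rw [hq1, hf1]
    simp only [wronskian, derivative_mul]
    ring
  have hw2 : wronskian q1 f1 = 0 := (mul_eq_zero.1 hw1).resolve_left (pow_ne_zero 2 hc0)
  have hd := (hcop.wronskian_eq_zero_iff.1 hw2).2
  have hf10 : f1 ≠ 0 := by
    rintro rfl
    exact hf (by rw [hf1, mul_zero])
  have hexp := expand_contract p hd (Fact.out : p.Prime).ne_zero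
  rw [ZMod.expand_card] at hexp
  have hf1deg : f1.natDegree ≠ 0 := by
    intro h0
    rw [hf1, natDegree_mul hc0 hf10, h0, add_zero] at hdeg
    have hq1' : q1 ≠ 0 := by
      rintro rfl
      exact hq (by rw [hq1, mul_zero])
    rw [hq1, natDegree_mul hc0 hq1'] at hdeg
    omega
  have hs1 : f1.Splits := hs.of_dvd hf ⟨c, by rw [hf1]; ring⟩
  obtain ⟨r, hr⟩ := hs1.exists_eval_eq_zero (by
    rw [degree_eq_natDegree hf10]; exact_mod_cast hf1deg)
  refine ⟨r, (le_rootMultiplicity_iff hf).2 ?_⟩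
  have h1 : (contract p f1).IsRoot r := by
    rw [← hexp, eval_pow] at hr
    exact pow_eq_zero_iff (Fact.out : p.Prime).ne_zero |>.1 hr
  have h2 := pow_dvd_pow_of_dvd (dvd_iff_isRoot.2 h1) p
  rw [hexp] at h2
  exact h2.trans ⟨c, by rw [hf1]; ring⟩

/-- A lower bound for the number of distinct roots of a split polynomial with a gap in its
coefficients and with all multiplicities less than `p`. With `f = X ^ p * q + r` and
`deg r ≤ d - p`, the derivative of `X ^ p` vanishes, so the Wronskian of `q` and `f` is that of `q`
and `r`; its degree is small, and it is divisible by `f` divided by its radical. -/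
theorem IsFrobeniusNull.card_roots_le {p d : ℕ} [Fact p.Prime] {f : (ZMod p)[X]}
    (hs : f.Splits) (hf : f ≠ 0) (hle : f.natDegree ≤ d) (hd : d < f.natDegree + p)
    (h : IsFrobeniusNull p d f) (hm : ∀ r, f.rootMultiplicity r < p) :
    2 * p + 1 ≤ f.roots.toFinset.card + d := by
  have hp : p.Prime := Fact.out
  have hpf : p ≤ f.natDegree := by
    by_contra! hlt
    exact leadingCoeff_ne_zero.2 hf (h _ hlt hd)
  set q := f /ₘ X ^ p with hq
  set r := f %ₘ X ^ p with hr
  have hqr : r + X ^ p * q = f := modByMonic_add_div f _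
  have hqdeg : q.natDegree = f.natDegree - p := by
    rw [hq, natDegree_divByMonic _ (monic_X_pow p), natDegree_X_pow]
  have hrp : r.natDegree < p := by
    have := natDegree_modByMonic_lt f (monic_X_pow (R := ZMod p) p) (by
      intro h1
      have := congrArg natDegree h1
      rw [natDegree_X_pow, natDegree_one] at this
      exact hp.ne_zero this)
    rwa [natDegree_X_pow] at this
  have hrdeg : r.natDegree ≤ d - p := by
    rw [natDegree_le_iff_coeff_eq_zero]
    intro i hi
    by_cases hip : i < p
    · rw [← h i hip (by omega), ← hqr, coeff_add, coeff_X_pow_mul', if_neg (by omega), add_zero]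
    · exact coeff_eq_zero_of_natDegree_lt (by omega)
  by_cases hw : wronskian q f = 0
  · obtain ⟨x, hx⟩ := exists_rootMultiplicity_of_wronskian_eq_zero hs hf
      (by
        intro h0
        rw [h0, mul_zero, add_zero] at hqr
        rw [hqr] at hrp
        omega)
      (by have := hp.pos; omega) hw
    exact absurd (hm x) (by omega)
  · have h1 := natDegree_le_natDegree_wronskian_add hs hf q hw
    have h2 : wronskian q f = wronskian q r := by
      rw [← hqr, wronskian_add_right]
      simp only [wronskian, derivative_mul, derivative_X_pow]
      simp
      ring
    have h3 := natDegree_wronskian_lt_add (h2 ▸ hw)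
    rw [h2] at h1
    omega

/-! ### Products of linear forms -/

theorem natDegree_prod_linear_le {K ι : Type*} [Field K] (a b : ι → K) (T : Finset ι) :
    (∏ i ∈ T, (C (a i) * X + C (b i))).natDegree ≤ T.card := by
  refine (natDegree_prod_le _ _).trans ?_
  rw [card_eq_sum_ones]
  exact sum_le_sum fun i _ => natDegree_linear_le

theorem linear_ne_zero {K : Type*} [Field K] {a b : K} (h : a ≠ 0 ∨ b ≠ 0) :
    C a * X + C b ≠ 0 := by
  intro h0
  have h1 : a = 0 := by simpa using congrArg (fun f => coeff f 1) h0
  have h2 : b = 0 := by simpa using congrArg (fun f => coeff f 0) h0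
  tauto

theorem mem_roots_prod_linear {K ι : Type*} [Field K] {a b : ι → K} {T : Finset ι}
    (h : ∀ i ∈ T, a i ≠ 0 ∨ b i ≠ 0) {r : K} :
    r ∈ (∏ i ∈ T, (C (a i) * X + C (b i))).roots ↔ ∃ i ∈ T, a i * r + b i = 0 := by
  rw [mem_roots (prod_ne_zero_iff.2 fun i hi => linear_ne_zero (h i hi)), IsRoot.def, eval_prod,
    prod_eq_zero_iff]
  simp

theorem rootMultiplicity_prod_linear_le {K ι : Type*} [Field K] [DecidableEq K] {a b : ι → K}
    {T : Finset ι} (h : ∀ i ∈ T, a i ≠ 0 ∨ b i ≠ 0) (r : K) :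
    (∏ i ∈ T, (C (a i) * X + C (b i))).rootMultiplicity r ≤
      (T.filter fun i => a i * r + b i = 0).card := by
  rw [← count_roots, roots_prod _ _ (prod_ne_zero_iff.2 fun i hi => linear_ne_zero (h i hi)),
    Multiset.count_bind, card_filter]
  refine sum_le_sum fun i hi => ?_
  rw [count_roots]
  split_ifs with h0
  · refine (rootMultiplicity_le_iff (linear_ne_zero (h i hi)) r 1).2 fun hdvd => ?_
    have := natDegree_le_of_dvd hdvd (linear_ne_zero (h i hi))
    rw [natDegree_pow, natDegree_X_sub_C] at this
    have h2 : (C (a i) * X + C (b i)).natDegree ≤ 1 := natDegree_linear_le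
    omega
  · rw [Nat.le_zero]
    exact rootMultiplicity_eq_zero (by simpa using h0)

theorem card_sub_le_natDegree_prod_linear {K ι : Type*} [Field K] [DecidableEq K] {a b : ι → K}
    {T : Finset ι} (h : ∀ i ∈ T, a i ≠ 0 ∨ b i ≠ 0) :
    T.card ≤ (∏ i ∈ T, (C (a i) * X + C (b i))).natDegree + (T.filter fun i => a i = 0).card := by
  rw [natDegree_prod _ _ fun i hi => linear_ne_zero (h i hi), card_filter, card_eq_sum_ones,
    ← sum_add_distrib]
  refine sum_le_sum fun i _ => ?_
  split_ifs with h0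
  · omega
  · rw [natDegree_linear h0]

/-- Given `2 * p - 1` nonzero linear forms over `ZMod p`, fewer than `p` of which vanish at any
given point of the projective line, one of them can be left out so that the product of the others
has a nonzero coefficient at `X ^ (p - 1)`, that is, lies outside `(X ^ p, Y ^ p)` as a binary form
of degree `2 * p - 2`. -/
theorem exists_coeff_prod_linear_ne_zero {p : ℕ} [Fact p.Prime] {ι : Type*} [DecidableEq ι]
    (a b : ι → ZMod p) (S : Finset ι) (hS : S.card = 2 * p - 1)
    (hne : ∀ i ∈ S, a i ≠ 0 ∨ b i ≠ 0)
    (hline : ∀ c d : ZMod p, c ≠ 0 ∨ d ≠ 0 → (S.filter fun i => a i * c + b i * d = 0).card < p) :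
    ∃ Q ⊆ S, Q.card = 2 * p - 2 ∧ (∏ i ∈ Q, (C (a i) * X + C (b i))).coeff (p - 1) ≠ 0 := by
  have hp : p.Prime := Fact.out
  have hp2 := hp.two_le
  let F : Finset ι → (ZMod p)[X] := fun T => ∏ i ∈ T, (C (a i) * X + C (b i))
  let N : Finset ι → Prop := fun T => IsFrobeniusNull p T.card (F T)
  have hNS : N S := fun i hi hd => by omega
  have hN0 : ¬ N ∅ := fun h => by simpa [F] using h 0 hp.pos (by simpa using hp.pos)
  have hins : ∀ T : Finset ι, ∀ i ∉ T, F (insert i T) = (C (a i) * X + C (b i)) * F T :=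
    fun T i hi => prod_insert hi
  have hmono : ∀ T : Finset ι, N T → ∀ i ∉ T, N (insert i T) := by
    intro T hT i hi
    simp only [N]
    rw [hins T i hi, card_insert_of_notMem hi]
    exact IsFrobeniusNull.linear_mul hT _ _
  -- `M` is a smallest set of forms whose product lies in `(X ^ p, Y ^ p)`.
  obtain ⟨M, ⟨hMS, hNM⟩, hmin⟩ : ∃ M, (M ⊆ S ∧ N M) ∧ ∀ T, T ⊆ S ∧ N T → M.card ≤ T.card := by
    classical
    obtain ⟨M, hM, hmin⟩ := exists_min_image (S.powerset.filter N) card ⟨S, by simp [hNS]⟩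
    simp only [mem_filter, mem_powerset] at hM hmin
    exact ⟨M, hM, hmin⟩
  have hcardSM : (S \ M).card + M.card = 2 * p - 1 := by
    rw [card_sdiff_add_card_eq_card hMS, hS]
  by_cases hpar : ∃ j ∈ M, ∀ i ∈ S \ M, a j * b i - a i * b j ≠ 0
  · -- The product over `M.erase j` is not null. Adding the forms of `S \ M`, none of which is
    -- proportional to the `j`-th form, one at a time keeps it so by the socle lemma, and it
    -- ends as the product over `S.erase j`, of degree `2 * p - 2`.
    obtain ⟨j, hj, hpar⟩ := hpar
    have key : ∀ U ⊆ S \ M, N (M ∪ U) ∧ ¬ N (M.erase j ∪ U) := by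
      intro U
      induction U using Finset.induction_on with
      | empty =>
        intro _
        rw [union_empty, union_empty]
        refine ⟨hNM, fun hN => ?_⟩
        have := hmin _ ⟨(erase_subset _ _).trans hMS, hN⟩
        have := card_erase_lt_of_mem hj
        omega
      | insert i U hi ih =>
        intro hU
        obtain ⟨h1, h2⟩ := ih ((subset_insert i U).trans hU)
        have hiM := mem_sdiff.1 (hU (mem_insert_self i U))
        have hUS : U ⊆ S := ((subset_insert i U).trans hU).trans sdiff_subset
        have hUM : ∀ x ∈ U, x ∉ M := fun x hx => (mem_sdiff.1 (hU (mem_insert_of_mem hx))).2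
        rw [union_insert, union_insert]
        refine ⟨hmono _ h1 i (by simp [hi, hiM.2]), fun hN => h2 ?_⟩
        have hjV : j ∉ M.erase j ∪ U := by
          simp only [mem_union, mem_erase]
          rintro (h | h)
          · exact h.1 rfl
          · exact hUM j h hj
        have hiV : i ∉ M.erase j ∪ U := by simp [hi, hiM.2]
        have hij : i ≠ j := by
          rintro rfl
          exact hiM.2 hj
        have hjV' : insert j (M.erase j ∪ U) = M ∪ U := by
          rw [← insert_union, insert_erase hj]
        rw [← hjV'] at h1
        simp only [N] at h1 hN ⊢
        rw [hins _ _ hjV, card_insert_of_notMem hjV] at h1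
        rw [hins _ _ hiV, card_insert_of_notMem hiV] at hN
        refine IsFrobeniusNull.of_linear_mul ?_ (hpar i (hU (mem_insert_self i U))) h1 hN
        have h3 : insert i (insert j (M.erase j ∪ U)) ⊆ S := by
          rw [hjV']
          exact insert_subset hiM.1 (union_subset hMS hUS)
        have h4 := card_le_card h3
        rw [card_insert_of_notMem (by simp [hij, hi, hiM.2]), card_insert_of_notMem hjV, hS] at h4
        omega
    have hQ : M.erase j ∪ S \ M = S.erase j := by
      ext i
      simp only [mem_union, mem_erase, mem_sdiff]
      have := @hMS i
      by_cases hij : i = j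
      · subst hij
        simp [hj]
      · tauto
    have h5 := (key _ Subset.rfl).2
    rw [hQ] at h5
    have hQc : (S.erase j).card = 2 * p - 2 := by
      rw [card_erase_of_mem (hMS hj), hS]
      omega
    refine ⟨S.erase j, erase_subset _ _, hQc, fun h0 => h5 fun i hi hd => ?_⟩
    rw [hQc] at hd
    obtain rfl : i = p - 1 := by omega
    exact h0
  · -- Every form of `M` is proportional to one of `S \ M`, so the product over `M` has at most
    -- `2 * p - 1 - M.card` distinct roots, fewer than the gap in its coefficients allows.
    push Not at hpar
    exfalso
    have hneM : ∀ i ∈ M, a i ≠ 0 ∨ b i ≠ 0 := fun i hi => hne i (hMS hi)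
    have hneSM : ∀ i ∈ S \ M, a i ≠ 0 ∨ b i ≠ 0 := fun i hi => hne i (mem_sdiff.1 hi).1
    have hroots : (F M).roots.toFinset ⊆ (F (S \ M)).roots.toFinset := by
      intro r hr
      rw [Multiset.mem_toFinset] at hr ⊢
      obtain ⟨j, hj, hjr⟩ := (mem_roots_prod_linear hneM).1 hr
      obtain ⟨i, hi, hij⟩ := hpar j hj
      refine (mem_roots_prod_linear hneSM).2 ⟨i, hi, ?_⟩
      have haj : a j ≠ 0 := by
        intro h0
        rw [h0, zero_mul, zero_add] at hjr
        exact (hneM j hj).elim (fun h => h h0) fun h => h hjr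
      refine (mul_eq_zero.1 (?_ : a j * (a i * r + b i) = 0)).resolve_left haj
      linear_combination a i * hjr + hij
    have h1 : (F M).roots.toFinset.card ≤ (S \ M).card :=
      (card_le_card hroots).trans ((Multiset.toFinset_card_le _).trans
        ((card_roots' _).trans (natDegree_prod_linear_le a b _)))
    have h2 := IsFrobeniusNull.card_roots_le (f := F M) (d := M.card)
      (Splits.prod fun i _ => Splits.of_natDegree_le_one natDegree_linear_le)
      (prod_ne_zero_iff.2 fun i hi => linear_ne_zero (hneM i hi))
      (natDegree_prod_linear_le a b M)
      (by
        have h3 := card_sub_le_natDegree_prod_linear hneM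
        have h4 := hline 1 0 (Or.inl one_ne_zero)
        simp only [mul_one, mul_zero, add_zero] at h4
        have h5 := card_le_card (filter_subset_filter (fun i => a i = 0) hMS)
        simp only [F]
        omega)
      hNM
      (fun r => by
        have h3 := rootMultiplicity_prod_linear_le hneM r
        have h4 := hline r 1 (Or.inr one_ne_zero)
        simp only [mul_one] at h4
        have h5 := card_le_card (filter_subset_filter (fun i => a i * r + b i = 0) hMS)
        simp only [F]
        omega)
    omega

/-! ### Subset sums in the plane over a prime field -/

theorem linear_mul_homogenization {K A : Type*} [CommRing K] [CommRing A] [Algebra K A] (a b : K)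
    (x y : A) {f : K[X]} {n : ℕ} (hf : f.natDegree ≤ n) :
    ∑ k ∈ range (n + 2), ((C a * X + C b) * f).coeff k • (x ^ k * y ^ (n + 1 - k)) =
      (a • x + b • y) * ∑ k ∈ range (n + 1), f.coeff k • (x ^ k * y ^ (n - k)) := by
  have h1 : ∑ k ∈ range (n + 2), (C a * X * f).coeff k • (x ^ k * y ^ (n + 1 - k)) =
      (a • x) * ∑ k ∈ range (n + 1), f.coeff k • (x ^ k * y ^ (n - k)) := by
    rw [sum_range_succ', mul_sum]
    simp only [mul_assoc, coeff_C_mul, coeff_X_mul, mul_coeff_zero, coeff_X_zero, zero_mul,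
      mul_zero, zero_smul, add_zero, Nat.add_sub_add_right]
    refine sum_congr rfl fun k _ => ?_
    rw [smul_mul_smul_comm]
    congr 1
    ring
  have h2 : ∑ k ∈ range (n + 2), (C b * f).coeff k • (x ^ k * y ^ (n + 1 - k)) =
      (b • y) * ∑ k ∈ range (n + 1), f.coeff k • (x ^ k * y ^ (n - k)) := by
    rw [sum_range_succ, mul_sum, coeff_C_mul, coeff_eq_zero_of_natDegree_lt (n := n + 1) (by omega),
      mul_zero, zero_smul, add_zero]
    refine sum_congr rfl fun k hk => ?_
    rw [coeff_C_mul, smul_mul_smul_comm, Nat.sub_add_comm (by simp at hk; omega)]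
    congr 1
    ring
  rw [add_mul (a • x), ← h1, ← h2, ← sum_add_distrib]
  refine sum_congr rfl fun k _ => ?_
  rw [add_mul, coeff_add, add_smul]

/-- A product of linear forms in `x` and `y`, expanded through its dehomogenization. -/
theorem prod_linear_eq_sum {K A ι : Type*} [Field K] [CommRing A] [Algebra K A]
    (a b : ι → K) (x y : A) (T : Finset ι) :
    ∏ i ∈ T, (a i • x + b i • y) = ∑ k ∈ range (T.card + 1),
      (∏ i ∈ T, (C (a i) * X + C (b i))).coeff k • (x ^ k * y ^ (T.card - k)) := by
  classical
  induction T using Finset.induction_on with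
  | empty => simp
  | insert i T hi ih =>
    rw [prod_insert hi, prod_insert hi, ih, card_insert_of_notMem hi,
      linear_mul_homogenization _ _ _ _ (natDegree_prod_linear_le a b T)]

theorem exists_one_add_pow_eq {A : Type*} [CommRing A] (x : A) (n : ℕ) :
    ∃ z, (1 + x) ^ n = 1 + n * x + z * x ^ 2 := by
  induction n with
  | zero => exact ⟨0, by simp⟩
  | succ n ih =>
    obtain ⟨z, hz⟩ := ih
    refine ⟨n + z + z * x, ?_⟩
    rw [pow_succ, hz]
    push_cast
    ring

theorem sub_one_pow_pred_eq_geom_sum {p : ℕ} [Fact p.Prime] {A : Type*} [CommRing A]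
    [Algebra (ZMod p) A] (x : A) : (x - 1) ^ (p - 1) = ∑ k ∈ range p, x ^ k := by
  have h : ((X : (ZMod p)[X]) - 1) ^ (p - 1) = ∑ k ∈ range p, X ^ k := by
    have h0 : ((X : (ZMod p)[X]) - 1) ≠ 0 := by simpa using X_sub_C_ne_zero (1 : ZMod p)
    refine mul_right_cancel₀ h0 ?_
    rw [geom_sum_mul, ← pow_succ, Nat.sub_add_cancel (Fact.out : p.Prime).pos, sub_pow_char,
      one_pow]
  simpa using congrArg (aeval x) h

/-- The ideal `(x, y)` has vanishing power `2 * p - 1` if `x ^ p = y ^ p = 0`. -/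
theorem sup_span_pow_eq_bot {A : Type*} [CommRing A] {x y : A} {p : ℕ}
    (hx : x ^ p = 0) (hy : y ^ p = 0) :
    (Ideal.span {x} ⊔ Ideal.span {y}) ^ (2 * p - 1) = ⊥ := by
  rw [← Ideal.add_eq_sup, add_pow]
  refine sum_eq_zero fun m _ => ?_
  rw [Ideal.span_singleton_pow, Ideal.span_singleton_pow]
  by_cases hm : p ≤ m
  · rw [← Nat.sub_add_cancel hm, pow_add, hx]
    simp
  · have hm' : p ≤ 2 * p - 1 - m := by omega
    rw [← Nat.sub_add_cancel hm', pow_add, hy]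
    simp

/-- A product of elements of `J` is determined modulo `J ^ (T.card + 1)` by the factors modulo
`J ^ 2`. -/
theorem prod_sub_prod_mem_pow {A ι : Type*} [CommRing A] {J : Ideal A} (u v : ι → A)
    (T : Finset ι) (hv : ∀ i ∈ T, v i ∈ J) (huv : ∀ i ∈ T, u i - v i ∈ J ^ 2) :
    ∏ i ∈ T, u i - ∏ i ∈ T, v i ∈ J ^ (T.card + 1) ∧ ∏ i ∈ T, v i ∈ J ^ T.card := by
  classical
  induction T using Finset.induction_on with
  | empty => simp
  | insert i T hi ih =>
    obtain ⟨h1, h2⟩ := ih (fun j hj => hv j (mem_insert_of_mem hj))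
      (fun j hj => huv j (mem_insert_of_mem hj))
    have hvi := hv i (mem_insert_self i T)
    have hui := huv i (mem_insert_self i T)
    have hui' : u i ∈ J := by
      have := J.add_mem (Ideal.pow_le_self two_ne_zero hui) hvi
      simpa using this
    rw [prod_insert hi, prod_insert hi, card_insert_of_notMem hi]
    constructor
    · have h3 : u i * ∏ i ∈ T, u i - v i * ∏ i ∈ T, v i =
          u i * (∏ i ∈ T, u i - ∏ i ∈ T, v i) + (u i - v i) * ∏ i ∈ T, v i := by ring
      rw [h3]
      refine Ideal.add_mem _ ?_ ?_
      · rw [pow_succ' J (T.card + 1)]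
        exact Ideal.mul_mem_mul hui' h1
      · rw [show T.card + 1 + 1 = 2 + T.card by ring, pow_add]
        exact Ideal.mul_mem_mul hui h2
    · rw [pow_succ']
      exact Ideal.mul_mem_mul hvi h2

/-- The group ring of `ZMod p × ZMod p` over `ZMod p` is `ZMod p [x, y] / (x ^ p, y ^ p)`, with
augmentation ideal `J = (x, y)` and `J ^ (2 * p - 1) = 0`. The product of the `2 * p - 2` elements
`e (a i, b i) - 1` of `J` equals the product of the linear forms `a i • x + b i • y`, hence the
coefficient in question times `x ^ (p - 1) * y ^ (p - 1)`, which is the sum of all group elements.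
So every group element occurs in the product, and it can occur only as a subset sum. -/
theorem exists_subset_sum_of_coeff_ne_zero {p : ℕ} [Fact p.Prime] {ι : Type*}
    (a b : ι → ZMod p) (Q : Finset ι) (hQ : Q.card = 2 * p - 2)
    (hcoeff : (∏ i ∈ Q, (C (a i) * X + C (b i))).coeff (p - 1) ≠ 0) (z : ZMod p × ZMod p) :
    ∃ T ⊆ Q, ∑ i ∈ T, (a i, b i) = z := by
  classical
  have hp : p.Prime := Fact.out
  have hp2 := hp.two_le
  let A := AddMonoidAlgebra (ZMod p) (ZMod p × ZMod p)
  let e : ZMod p × ZMod p → A := fun g => AddMonoidAlgebra.single g 1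
  have he_add : ∀ g h, e (g + h) = e g * e h := fun g h => by
    have := AddMonoidAlgebra.single_mul_single g h (1 : ZMod p) 1
    rw [mul_one] at this
    exact this.symm
  have he_zero : e 0 = 1 := rfl
  have he_nsmul : ∀ (n : ℕ) g, e (n • g) = e g ^ n := fun n g => by
    have := AddMonoidAlgebra.single_pow g (1 : ZMod p) n
    rw [one_pow] at this
    exact this.symm
  have he_sum : ∀ (T : Finset ι) (f : ι → ZMod p × ZMod p),
      e (∑ i ∈ T, f i) = ∏ i ∈ T, e (f i) := by
    intro T f
    induction T using Finset.induction_on with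
    | empty => rfl
    | insert i T hi ih => rw [sum_insert hi, prod_insert hi, he_add, ih]
  have he_char : ∀ g, (e g - 1) ^ p = 0 := fun g => by
    have : CharP A p := charP_of_injective_algebraMap (algebraMap (ZMod p) A).injective p
    rw [sub_pow_char, one_pow, ← he_nsmul, sub_eq_zero, ← he_zero]
    congr 1
    ext <;> simp
  set x : A := e (1, 0) - 1 with hx
  set y : A := e (0, 1) - 1 with hy
  set J : Ideal A := Ideal.span {x} ⊔ Ideal.span {y} with hJ
  have hxJ : x ∈ J := Ideal.mem_sup_left (Ideal.mem_span_singleton_self x)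
  have hyJ : y ∈ J := Ideal.mem_sup_right (Ideal.mem_span_singleton_self y)
  have he_coord : ∀ m n : ZMod p, e (m, n) = (1 + x) ^ m.val * (1 + y) ^ n.val := by
    intro m n
    rw [hx, hy, add_sub_cancel, add_sub_cancel, ← he_nsmul, ← he_nsmul, ← he_add]
    congr 1
    ext <;> simp
  have hsmul : ∀ (m : ZMod p) (w : A), m • w = (m.val : A) * w := by
    intro m w
    conv_lhs => rw [← ZMod.natCast_zmod_val m]
    rw [Nat.cast_smul_eq_nsmul, nsmul_eq_mul]
  -- Modulo `J ^ 2`, the element `e (m, n) - 1` is the linear form `m • x + n • y`.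
  have hlin : ∀ m n : ZMod p, e (m, n) - 1 - (m • x + n • y) ∈ J ^ 2 := by
    intro m n
    obtain ⟨z1, h1⟩ := exists_one_add_pow_eq x m.val
    obtain ⟨z2, h2⟩ := exists_one_add_pow_eq y n.val
    have hxx : x ^ 2 ∈ J ^ 2 := Ideal.pow_mem_pow hxJ 2
    have hyy : y ^ 2 ∈ J ^ 2 := Ideal.pow_mem_pow hyJ 2
    have hxy : x * y ∈ J ^ 2 := by
      rw [pow_two]
      exact Ideal.mul_mem_mul hxJ hyJ
    rw [he_coord, h1, h2, hsmul, hsmul]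
    have : (1 + (m.val : A) * x + z1 * x ^ 2) * (1 + (n.val : A) * y + z2 * y ^ 2) - 1 -
        ((m.val : A) * x + (n.val : A) * y) =
        z1 * (1 + (n.val : A) * y + z2 * y ^ 2) * x ^ 2 + z2 * (1 + (m.val : A) * x) * y ^ 2 +
          (m.val : A) * (n.val : A) * (x * y) := by ring
    rw [this]
    exact Ideal.add_mem _ (Ideal.add_mem _ (Ideal.mul_mem_left _ _ hxx)
      (Ideal.mul_mem_left _ _ hyy))
      (Ideal.mul_mem_left _ _ hxy)
  have hprod := (prod_sub_prod_mem_pow (fun i => e (a i, b i) - 1)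
    (fun i => a i • x + b i • y) Q
    (fun i _ => J.add_mem (Submodule.smul_of_tower_mem J _ hxJ)
      (Submodule.smul_of_tower_mem J _ hyJ))
    (fun i _ => hlin _ _)).1
  rw [hQ, show 2 * p - 2 + 1 = 2 * p - 1 by omega, hJ,
    sup_span_pow_eq_bot (he_char _) (he_char _), Ideal.mem_bot, sub_eq_zero,
    prod_linear_eq_sum, hQ, sum_eq_single_of_mem (p - 1) (by simp; omega)] at hprod
  swap
  · intro k hk hkp
    rw [mem_range] at hk
    rcases lt_or_gt_of_ne hkp with h | h
    · rw [← Nat.sub_add_cancel (show p ≤ 2 * p - 2 - k by omega), pow_add, he_char]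
      simp
    · rw [← Nat.sub_add_cancel (show p ≤ k by omega), pow_add, he_char]
      simp
  rw [show 2 * p - 2 - (p - 1) = p - 1 by omega, sub_one_pow_pred_eq_geom_sum,
    sub_one_pow_pred_eq_geom_sum, sum_mul_sum] at hprod
  by_contra! hcon
  -- Expanding the product over subsets shows that its coefficient at `z` vanishes if `z` is not a
  -- subset sum.
  have hL : (∏ i ∈ Q, (e (a i, b i) - 1)).coeff z = 0 := by
    simp only [sub_eq_add_neg]
    rw [prod_add, AddMonoidAlgebra.coeff_sum, Finsupp.finsetSum_apply]
    refine sum_eq_zero fun T hT => ?_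
    rw [← he_sum, prod_const]
    have : (e (∑ i ∈ T, (a i, b i)) * (-1) ^ (Q \ T).card : A) =
        AddMonoidAlgebra.single (∑ i ∈ T, (a i, b i)) ((-1) ^ (Q \ T).card) := by
      rcases neg_one_pow_eq_or (ZMod p) (Q \ T).card with h | h
      · rcases Nat.even_or_odd (Q \ T).card with h' | h'
        · simp [h'.neg_one_pow, e]
        · rw [h'.neg_one_pow, h'.neg_one_pow]
          simp [e]
      · rcases Nat.even_or_odd (Q \ T).card with h' | h'
        · simp [h'.neg_one_pow, e]
        · rw [h'.neg_one_pow, h'.neg_one_pow]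
          simp [e]
    rw [this, AddMonoidAlgebra.coeff_single, Finsupp.single_apply,
      if_neg (hcon T (mem_powerset.1 hT))]
  rw [hprod, AddMonoidAlgebra.coeff_smul, Finsupp.smul_apply, smul_eq_mul, mul_eq_zero,
    or_iff_right hcoeff, AddMonoidAlgebra.coeff_sum, Finsupp.finsetSum_apply] at hL
  have h1 : ∀ k ∈ range p, ∀ l ∈ range p, (e (1, 0) ^ k * e (0, 1) ^ l).coeff z =
      if k = z.1.val ∧ l = z.2.val then 1 else 0 := by
    intro k hk l hl
    rw [mem_range] at hk hl
    rw [← he_nsmul, ← he_nsmul, ← he_add]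
    simp only [e, AddMonoidAlgebra.coeff_single, Finsupp.single_apply]
    refine if_congr ?_ rfl rfl
    simp only [Prod.ext_iff, Prod.fst_add, Prod.smul_fst, Prod.snd_add, Prod.smul_snd, smul_zero,
      add_zero, zero_add]
    simp only [nsmul_eq_mul, mul_one]
    constructor
    · rintro ⟨h1, h2⟩
      rw [← h1, ← h2, ZMod.val_cast_of_lt hk, ZMod.val_cast_of_lt hl]
      exact ⟨rfl, rfl⟩
    · rintro ⟨h1, h2⟩
      rw [h1, h2, ZMod.natCast_zmod_val, ZMod.natCast_zmod_val]
      exact ⟨rfl, rfl⟩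
  have h2 : ∑ k ∈ range p, (∑ l ∈ range p, e (1, 0) ^ k * e (0, 1) ^ l).coeff z =
      ∑ k ∈ range p, ∑ l ∈ range p, if k = z.1.val ∧ l = z.2.val then (1 : ZMod p) else 0 := by
    refine sum_congr rfl fun k hk => ?_
    rw [AddMonoidAlgebra.coeff_sum, Finsupp.finsetSum_apply]
    exact sum_congr rfl fun l hl => h1 k hk l hl
  rw [h2] at hL
  simp [ite_and, ZMod.val_lt] at hL

/-- In `ZMod p × ZMod p`, any `2 * p - 1` nonzero terms of which fewer than `p` lie on each line
through the origin have every element as a subset sum. -/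
theorem exists_subset_sum_eq_of_card_line_lt {p : ℕ} [Fact p.Prime] {ι : Type*} (S : Finset ι)
    (g : ι → ZMod p × ZMod p) (hS : 2 * p - 1 ≤ S.card) (hne : ∀ i ∈ S, g i ≠ 0)
    (hline : ∀ c d : ZMod p, c ≠ 0 ∨ d ≠ 0 →
      (S.filter fun i => (g i).1 * c + (g i).2 * d = 0).card < p) (z : ZMod p × ZMod p) :
    ∃ T ⊆ S, ∑ i ∈ T, g i = z := by
  classical
  obtain ⟨S', hS', hcard⟩ := exists_subset_card_eq hS
  obtain ⟨Q, hQ, hQc, hcoeff⟩ := exists_coeff_prod_linear_ne_zero (fun i => (g i).1)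
    (fun i => (g i).2) S' hcard (fun i hi => by
      by_contra! h
      exact hne i (hS' hi) (Prod.ext h.1 h.2))
    (fun c d hcd => (card_le_card (filter_subset_filter _ hS')).trans_lt (hline c d hcd))
  obtain ⟨T, hT, hsum⟩ := exists_subset_sum_of_coeff_ne_zero _ _ Q hQc hcoeff z
  exact ⟨T, hT.trans (hQ.trans hS'), hsum⟩

end

/-! ### Lengths of uniquely zero-sum families in small groups -/

namespace IsUniquelyZeroSum

variable {ι G H : Type*} [DecidableEq ι] [AddCommGroup G] [AddCommGroup H]
  {s : Finset ι} {g : ι → G}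

/-- A uniquely zero-sum family has at most `p` terms in a subgroup of order `p`: otherwise, setting
aside a term `u` and its partner, the remaining terms still cover `-g u`. -/
theorem card_le_of_mem_of_card_prime (h : IsUniquelyZeroSum s g) {p : ℕ} (hp : p.Prime)
    (K : AddSubgroup G) (hK : Nat.card K = p) {A : Finset ι} (hA : A ⊆ s)
    (hAK : ∀ i ∈ A, g i ∈ K) : A.card ≤ p := by
  by_contra! hlt
  obtain ⟨u, hu⟩ := card_pos.1 (hp.pos.trans hlt)
  obtain ⟨v, hvu, hv⟩ := h.exists_partner (hA hu)
  have hB : (A.erase u).erase v ⊆ A := (erase_subset _ _).trans (erase_subset _ _)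
  obtain ⟨t, ht, hsum⟩ := K.exists_subset_sum_eq hp hK ((A.erase u).erase v) g
    (fun i hi => hAK i (hB hi)) (fun i hi => h.ne_zero i (hA (hB hi)))
    (by
      have h1 := pred_card_le_card_erase (s := A.erase u) (a := v)
      have h2 := card_erase_of_mem hu
      omega) (K.neg_mem (hAK u hu))
  have hut : u ∉ t := fun hut => by simpa using ht hut
  have hvt : v ∉ t := fun hvt => by simpa using ht hvt
  have := hv (insert u t) (insert_subset (hA hu) (ht.trans (hB.trans hA)))
    (by rw [sum_insert hut, hsum, add_neg_cancel]) (mem_insert_self u t)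
  rcases mem_insert.1 this with h1 | h1
  · exact hvu h1
  · exact hvt h1

/-- A uniquely zero-sum family over `ZMod p × ZMod p` has at most `2 * p` terms. If some line
contains `p - 1` of the terms, they cover the line, and the problem splits into the line and the
quotient by it; otherwise, setting aside a term `u` and its partner, `2 * p - 1` further terms
cover `-g u`. -/
theorem card_le_two_mul {p : ℕ} [Fact p.Prime] {g : ι → ZMod p × ZMod p}
    (h : IsUniquelyZeroSum s g) : s.card ≤ 2 * p := by
  have hp : p.Prime := Fact.out
  by_cases hheavy : ∃ c d : ZMod p, (c ≠ 0 ∨ d ≠ 0) ∧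
      p ≤ (s.filter fun i => (g i).1 * c + (g i).2 * d = 0).card + 1
  · obtain ⟨c, d, hcd, hheavy⟩ := hheavy
    let π : ZMod p × ZMod p →+ ZMod p :=
      ((AddMonoidHom.mulRight c).comp (AddMonoidHom.fst _ _)) +
        ((AddMonoidHom.mulRight d).comp (AddMonoidHom.snd _ _))
    have hπ : ∀ x, π x = x.1 * c + x.2 * d := fun x => rfl
    have hsurj : Function.Surjective π := by
      intro x
      rcases hcd with hc | hd
      · exact ⟨(x * c⁻¹, 0), by rw [hπ]; simp [hc]⟩
      · exact ⟨(0, x * d⁻¹), by rw [hπ]; simp [hd]⟩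
    have hker : Nat.card π.ker = p := by
      have h1 := π.ker.card_mul_index
      rw [AddSubgroup.index_ker, AddMonoidHom.range_eq_top.2 hsurj] at h1
      simp only [Nat.card_prod, Nat.card_zmod, AddSubgroup.card_top] at h1
      exact Nat.eq_of_mul_eq_mul_right hp.pos h1
    have hq := h.quotient π (fun U _ hU => by
      refine π.ker.exists_subset_sum_eq hp hker (s.filter fun i => π (g i) = 0) g
        (fun i hi => AddMonoidHom.mem_ker.2 (mem_filter.1 hi).2)
        (fun i hi => h.ne_zero i (mem_filter.1 hi).1) hheavy (π.ker.neg_mem ?_)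
      rw [AddMonoidHom.mem_ker, map_sum]
      exact hU)
    have h1 := hq.card_le_of_mem_of_card_prime hp ⊤ (by simp) Subset.rfl
      (fun _ _ => AddSubgroup.mem_top _)
    have h2 := h.card_le_of_mem_of_card_prime hp π.ker hker (A := s.filter fun i => π (g i) = 0)
      (filter_subset _ _) (fun i hi => AddMonoidHom.mem_ker.2 (mem_filter.1 hi).2)
    have h3 := card_filter_add_card_filter_not (s := s) (fun i => π (g i) = 0)
    omega
  · push Not at hheavy
    by_contra! hlt
    obtain ⟨u, hu⟩ := card_pos.1 (Nat.zero_lt_of_lt hlt)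
    obtain ⟨v, hvu, hv⟩ := h.exists_partner hu
    have hB : (s.erase u).erase v ⊆ s := (erase_subset _ _).trans (erase_subset _ _)
    obtain ⟨t, ht, hsum⟩ := exists_subset_sum_eq_of_card_line_lt ((s.erase u).erase v) g
      (by
        have h1 := pred_card_le_card_erase (s := s.erase u) (a := v)
        have h2 := card_erase_of_mem hu
        omega)
      (fun i hi => h.ne_zero i (hB hi))
      (fun c d hcd => by
        have h1 := hheavy c d hcd
        have h2 := card_le_card
          (filter_subset_filter (fun i => (g i).1 * c + (g i).2 * d = 0) hB)
        omega) (-g u)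
    have hut : u ∉ t := fun hut => by simpa using ht hut
    have hvt : v ∉ t := fun hvt => by simpa using ht hvt
    have := hv (insert u t) (insert_subset hu (ht.trans hB))
      (by rw [sum_insert hut, hsum, add_neg_cancel]) (mem_insert_self u t)
    rcases mem_insert.1 this with h1 | h1
    · exact hvu h1
    · exact hvt h1

end IsUniquelyZeroSum

/-! ### Merge-reduced families -/

/-- The inverse of the additive order, as a real number; it is `0` for elements of infinite order.
-/
noncomputable def invOrder {G : Type*} [AddCommGroup G] (x : G) : ℝ := (addOrderOf x : ℝ)⁻¹

theorem invOrder_nonneg {G : Type*} [AddCommGroup G] (x : G) : 0 ≤ invOrder x := by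
  unfold invOrder
  positivity

/-- Merging two or more terms into a nonzero one always lowers the sum of the inverse orders. -/
def IsMergeReduced {ι G : Type*} [AddCommGroup G] (s : Finset ι) (g : ι → G) : Prop :=
  ∀ T ⊆ s, 2 ≤ T.card → ∑ i ∈ T, g i ≠ 0 → invOrder (∑ i ∈ T, g i) < ∑ i ∈ T, invOrder (g i)

/-- A bound for the sum of the inverse orders of all uniquely zero-sum families with terms in `M`
need only be proved for the merge-reduced ones, by induction on the number of terms. -/
theorem IsUniquelyZeroSum.sum_invOrder_le_of_reduced {ι G : Type*} [DecidableEq ι]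
    [AddCommGroup G] (M : AddSubgroup G) (B : ℝ)
    (hB : ∀ (s : Finset ι) (g : ι → G), IsUniquelyZeroSum s g → (∀ i ∈ s, g i ∈ M) →
      IsMergeReduced s g → ∑ i ∈ s, invOrder (g i) ≤ B)
    (s : Finset ι) (g : ι → G) (h : IsUniquelyZeroSum s g) (hM : ∀ i ∈ s, g i ∈ M) :
    ∑ i ∈ s, invOrder (g i) ≤ B := by
  induction hn : s.card using Nat.strong_induction_on generalizing s g with
  | _ n ih =>
    by_cases hred : IsMergeReduced s g
    · exact hB s g h hM hred
    · unfold IsMergeReduced at hred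
      push Not at hred
      obtain ⟨T, hT, hcard, hne, hle⟩ := hred
      obtain ⟨a, ha⟩ := card_pos.1 (zero_lt_two.trans_le hcard)
      have hmem : ∀ i ∈ insert a (s \ T), Function.update g a (∑ i ∈ T, g i) i ∈ M := by
        intro i hi
        by_cases hia : i = a
        · subst hia
          rw [Function.update_self]
          exact M.sum_mem fun j hj => hM j (hT hj)
        · rw [Function.update_of_ne hia]
          exact hM i (mem_sdiff.1 ((mem_insert.1 hi).resolve_left hia)).1
      have hlt : (insert a (s \ T)).card < n := by
        rw [card_insert_of_notMem (by simp [ha])]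
        have := card_sdiff_add_card_eq_card hT
        omega
      have := ih _ hlt _ _ (h.merge hT ha hne) hmem rfl
      rw [sum_update_insert_sdiff ha] at this
      rw [← sum_sdiff hT]
      linarith

/-- In a merge-reduced family, at most `p` terms have the same order `p * d`, if they have nonzero
images in a group of order `p` such that subset sums with trivial image are killed by `d`. A
zero-sum set of at most `p` images comes from a subset whose sum has order dividing `d`; merging it
would not lower the sum of the inverse orders, so its sum is zero. With more than `p` terms such a
subset exists that contains a given term `u` but not its partner. -/
theorem IsUniquelyZeroSum.card_le_of_reduced {ι G H : Type*} [DecidableEq ι] [AddCommGroup G]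
    [AddCommGroup H] {s : Finset ι} {g : ι → G} (h : IsUniquelyZeroSum s g)
    (hred : IsMergeReduced s g) {p : ℕ} (hp : p.Prime) (θ : G →+ H) (K : AddSubgroup H)
    (hK : Nat.card K = p) {A : Finset ι} (hA : A ⊆ s) (hθK : ∀ i ∈ A, θ (g i) ∈ K)
    (hθ : ∀ i ∈ A, θ (g i) ≠ 0) {d : ℕ} (hd : 0 < d) (hord : ∀ i ∈ A, addOrderOf (g i) = p * d)
    (hsum : ∀ T ⊆ A, θ (∑ i ∈ T, g i) = 0 → d • ∑ i ∈ T, g i = 0) : A.card ≤ p := by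
  by_contra! hlt
  obtain ⟨u, hu⟩ := card_pos.1 (hp.pos.trans hlt)
  obtain ⟨v, hvu, hv⟩ := h.exists_partner (hA hu)
  have hBA : (A.erase u).erase v ⊆ A := (erase_subset _ _).trans (erase_subset _ _)
  obtain ⟨B, hB, hBc⟩ := exists_subset_card_eq (s := (A.erase u).erase v) (n := p - 1) (by
    have h1 := pred_card_le_card_erase (s := A.erase u) (a := v)
    have h2 := card_erase_of_mem hu
    omega)
  obtain ⟨t, ht, htsum⟩ := K.exists_subset_sum_eq hp hK B (fun i => θ (g i))
    (fun i hi => hθK i (hBA (hB hi))) (fun i hi => hθ i (hBA (hB hi))) (by omega)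
    (K.neg_mem (hθK u hu))
  have hut : u ∉ t := fun hut => by simpa using hB (ht hut)
  have hvt : v ∉ t := fun hvt => by simpa using hB (ht hvt)
  have hTA : insert u t ⊆ A := insert_subset hu (ht.trans (hB.trans hBA))
  have hTθ : θ (∑ i ∈ insert u t, g i) = 0 := by
    rw [map_sum, sum_insert hut, htsum, add_neg_cancel]
  have hTcard : (insert u t).card ≤ p := by
    rw [card_insert_of_notMem hut]
    have := card_le_card ht
    have := hp.pos
    omega
  have htne : t.Nonempty := by
    rw [nonempty_iff_ne_empty]
    rintro rfl
    rw [sum_empty] at htsum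
    exact hθ u hu (neg_eq_zero.1 htsum.symm)
  have hT0 : ∑ i ∈ insert u t, g i = 0 := by
    by_contra hne
    have h1 := hred _ (hTA.trans hA) (by
      rw [card_insert_of_notMem hut]
      have := card_pos.2 htne
      omega) hne
    have h2 : addOrderOf (∑ i ∈ insert u t, g i) ∣ d :=
      addOrderOf_dvd_of_nsmul_eq_zero (hsum _ hTA hTθ)
    have h3 : (d : ℝ)⁻¹ ≤ invOrder (∑ i ∈ insert u t, g i) := by
      unfold invOrder
      have : 0 < addOrderOf (∑ i ∈ insert u t, g i) := Nat.pos_of_dvd_of_pos h2 hd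
      gcongr
      exact Nat.le_of_dvd hd h2
    have h4 : ∑ i ∈ insert u t, invOrder (g i) = (insert u t).card * ((p : ℝ) * d)⁻¹ := by
      rw [← nsmul_eq_mul, ← sum_const]
      refine sum_congr rfl fun i hi => ?_
      rw [invOrder, hord i (hTA hi)]
      push_cast
      rfl
    have h5 : ((insert u t).card : ℝ) * ((p : ℝ) * d)⁻¹ ≤ (d : ℝ)⁻¹ := by
      have hp0 : (0 : ℝ) < p := by exact_mod_cast hp.pos
      have hd0 : (0 : ℝ) < d := by exact_mod_cast hd
      have hc : ((insert u t).card : ℝ) ≤ p := by exact_mod_cast hTcard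
      calc ((insert u t).card : ℝ) * ((p : ℝ) * d)⁻¹ ≤ p * ((p : ℝ) * d)⁻¹ := by gcongr
        _ = (d : ℝ)⁻¹ := by field_simp
    rw [h4] at h1
    linarith
  rcases mem_insert.1 (hv _ (hTA.trans hA) hT0 (mem_insert_self u t)) with h1 | h1
  · exact hvu h1
  · exact hvt h1

/-- The number `B` is an upper bound for the sums of the inverse orders of the uniquely zero-sum
families over `G`. Index types in `Type` are general enough. -/
def CrossNumberBound (G : Type*) [AddCommGroup G] (B : ℝ) : Prop :=
  ∀ (ι : Type) [DecidableEq ι] (s : Finset ι) (g : ι → G), IsUniquelyZeroSum s g →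
    ∑ i ∈ s, invOrder (g i) ≤ B

/-! ### Bounds for products with a cyclic group -/

/-- Passing to an element of smaller order, by divisibility, does not lower the inverse order; an
element of infinite order has inverse order `0`. -/
theorem invOrder_le_of_dvd {G H : Type*} [AddCommGroup G] [AddCommGroup H] {x : G} {y : H}
    (hy : 0 < addOrderOf y) (h : addOrderOf y ∣ addOrderOf x) : invOrder x ≤ invOrder y := by
  unfold invOrder
  rcases Nat.eq_zero_or_pos (addOrderOf x) with h0 | h0
  · rw [h0]
    simp
  · gcongr
    exact Nat.le_of_dvd h0 h

theorem sum_Ico_inv_pow {p : ℕ} (hp : 0 < p) {k α : ℕ} (hk : k ≤ α) :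
    ∑ l ∈ Ico (k + 1) (α + 1), ((p : ℝ) ^ l)⁻¹ * p + ∑ j ∈ range k, ((p : ℝ) ^ j)⁻¹ =
      ∑ j ∈ range α, ((p : ℝ) ^ j)⁻¹ := by
  have hp0 : (p : ℝ) ≠ 0 := by positivity
  rw [← sum_Ico_add' (fun l => ((p : ℝ) ^ l)⁻¹ * p) k α 1, add_comm, range_eq_Ico, range_eq_Ico,
    ← sum_Ico_consecutive _ (Nat.zero_le k) hk]
  congr 1
  refine sum_congr rfl fun l _ => ?_
  rw [pow_succ]
  field_simp

/-- The geometric sum behind the constant in the definition of 2-wide. Here `a l` is the number of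
terms of order `p ^ l`, and `2 * (p - 1) / p` accounts for all other terms with `p`-part `p ^ l` of
the order. The saving of two terms at level `k + 1` pays for the excess at all levels above `k`. -/
theorem sum_Ico_inv_pow_mul_le {p : ℕ} (hp : 0 < p) {k α : ℕ} (hk : k < α) (a : ℕ → ℝ)
    (hak : a (k + 1) ≤ p - 2) (ha : ∀ l, k + 1 < l → l ≤ α → a l ≤ p) :
    ∑ l ∈ Ico (k + 1) (α + 1), ((p : ℝ) ^ l)⁻¹ * (a l + 2 * (p - 1) / p) ≤
      ∑ l ∈ Ico (k + 1) (α + 1), ((p : ℝ) ^ l)⁻¹ * p - 2 / p * ((p : ℝ) ^ α)⁻¹ := by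
  have hp0 : (0 : ℝ) < p := by exact_mod_cast hp
  have hdiv : 2 * ((p : ℝ) - 1) / p = 2 - 2 / p := by field_simp
  rw [hdiv]
  induction α, hk using Nat.le_induction with
  | base =>
    rw [Nat.succ_eq_add_one, Nat.Ico_succ_singleton, sum_singleton, sum_singleton]
    have h : (0 : ℝ) ≤ ((p : ℝ) ^ (k + 1))⁻¹ := by positivity
    nlinarith [mul_le_mul_of_nonneg_left hak h]
  | succ α hkα ih =>
    have hk1 : k + 1 ≤ α + 1 := by omega
    rw [sum_Ico_succ_top hk1, sum_Ico_succ_top hk1]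
    have ih := ih fun l h1 h2 => ha l h1 (by omega)
    have h : (0 : ℝ) ≤ ((p : ℝ) ^ (α + 1))⁻¹ := by positivity
    have h1 := mul_le_mul_of_nonneg_left (ha (α + 1) (by omega) le_rfl) h
    have h2 : 2 / (p : ℝ) * ((p : ℝ) ^ α)⁻¹ = 2 * ((p : ℝ) ^ (α + 1))⁻¹ := by
      rw [pow_succ]
      field_simp
    rw [h2] at ih
    linarith

section Levels

variable {ι G C : Type*} [DecidableEq ι] [AddCommGroup G] [AddCommGroup C]
  {s : Finset ι}

/-- If there are `p - 1` terms of each order `p ^ l` with `1 ≤ l ≤ α`, then every element killed by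
`p ^ α` is a subset sum, by correcting one level after the other from the top. -/
theorem exists_subset_sum_of_levels {p : ℕ} (hp : p.Prime)
    (hC : Nat.card (nsmulAddMonoidHom (α := C) p).ker = p) (f : ι → C) (lev : ι → ℕ) (α : ℕ)
    (hlev : ∀ i ∈ s, addOrderOf (f i) = p ^ lev i)
    (hcard : ∀ l, 1 ≤ l → l ≤ α → p ≤ (s.filter fun i => lev i = l).card + 1) (z : C)
    (hz : p ^ α • z = 0) : ∃ V ⊆ s, (∀ i ∈ V, lev i ≤ α) ∧ ∑ i ∈ V, f i = z := by
  induction α generalizing z with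
  | zero => exact ⟨∅, empty_subset _, by simp, by simpa using hz.symm⟩
  | succ α ih =>
    obtain ⟨t, ht, hsum⟩ := (nsmulAddMonoidHom (α := C) p).ker.exists_subset_sum_eq hp hC
      (s.filter fun i => lev i = α + 1) (fun i => p ^ α • f i)
      (fun i hi => by
        rw [mem_filter] at hi
        rw [AddMonoidHom.mem_ker, nsmulAddMonoidHom_apply, ← mul_nsmul, ← pow_succ, ← hi.2,
          ← hlev i hi.1, addOrderOf_nsmul_eq_zero])
      (fun i hi h0 => by
        rw [mem_filter] at hi
        have := addOrderOf_dvd_of_nsmul_eq_zero h0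
        rw [hlev i hi.1, hi.2, Nat.pow_dvd_pow_iff_le_right hp.one_lt] at this
        omega)
      (hcard _ (by omega) le_rfl) (c := p ^ α • z)
      (by rw [AddMonoidHom.mem_ker, nsmulAddMonoidHom_apply, ← mul_nsmul, ← pow_succ, hz])
    rw [← smul_sum] at hsum
    obtain ⟨V, hV, hVlev, hVsum⟩ := ih (fun l h1 h2 => hcard l h1 (by omega))
      (z - ∑ i ∈ t, f i) (by rw [smul_sub, hsum, sub_self])
    refine ⟨t ∪ V, union_subset (ht.trans (filter_subset _ _)) hV, fun i hi => ?_, ?_⟩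
    · rcases mem_union.1 hi with h | h
      · exact (mem_filter.1 (ht h)).2.le
      · exact (hVlev i h).trans (Nat.le_succ α)
    · rw [sum_union, hVsum, add_sub_cancel]
      rw [disjoint_left]
      intro i hit hiV
      have h1 := (mem_filter.1 (ht hit)).2
      have h2 := hVlev i hiV
      omega

/-- A bound `B` for a group `G` of exponent dividing `E`, coprime to `p`, gives the bound
`B + ∑ j ∈ range α, p ^ (-j)` for families over `G × C` with second components killed by `p ^ α`,
where `C` has just `p` elements of order dividing `p`. The family may be taken merge-reduced, so
that for each `l ≥ 1` and `d ∣ E` at most `p` terms have order `d * p ^ l`. -/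
theorem sum_invOrder_le_of_prod_cyclic {E : ℕ} (hE : 0 < E) (hGE : ∀ x : G, E • x = 0) {p : ℕ}
    (hp : p.Prime) (hcop : E.Coprime p) (hC : Nat.card (nsmulAddMonoidHom (α := C) p).ker = p)
    (hwide : ∑ d ∈ E.divisors, (d : ℝ)⁻¹ ≤ 1 + 2 * (p - 1) / (p : ℝ) ^ 2) {B : ℝ}
    (hG : ∀ (s : Finset ι) (g : ι → G), IsUniquelyZeroSum s g → ∑ i ∈ s, invOrder (g i) ≤ B)
    (α : ℕ) (s : Finset ι) (g : ι → G × C) (h : IsUniquelyZeroSum s g)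
    (hα : ∀ i ∈ s, p ^ α • (g i).2 = 0) :
    ∑ i ∈ s, invOrder (g i) ≤ B + ∑ j ∈ range α, ((p : ℝ) ^ j)⁻¹ := by
  classical
  induction α using Nat.strong_induction_on generalizing s g with
  | _ α ih =>
  let M : ℕ → AddSubgroup (G × C) := fun k =>
    ((nsmulAddMonoidHom (α := C) (p ^ k)).comp (AddMonoidHom.snd G C)).ker
  have hmemM : ∀ k x, x ∈ M k ↔ p ^ k • x.2 = 0 := fun k x => AddMonoidHom.mem_ker
  refine IsUniquelyZeroSum.sum_invOrder_le_of_reduced (M α) _ (fun s g h hM hred => ?_) s g h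
    (fun i hi => (hmemM _ _).2 (hα i hi))
  have hp0 : (0 : ℝ) < p := by exact_mod_cast hp.pos
  let lev : ι → ℕ := fun i => Nat.log p (addOrderOf (g i).2)
  have hlev : ∀ i ∈ s, addOrderOf (g i).2 = p ^ lev i ∧ lev i ≤ α := by
    intro i hi
    obtain ⟨l, hl, hord⟩ := (Nat.dvd_prime_pow hp).1
      (addOrderOf_dvd_of_nsmul_eq_zero ((hmemM _ _).1 (hM i hi)))
    have : lev i = l := by simp only [lev, hord, Nat.log_pow hp.one_lt]
    rw [this]
    exact ⟨hord, hl⟩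
  have hfst : ∀ x : G, addOrderOf x ∣ E := fun x => addOrderOf_dvd_of_nsmul_eq_zero (hGE x)
  have hord : ∀ i ∈ s, addOrderOf (g i) = addOrderOf (g i).1 * p ^ lev i := by
    intro i hi
    rw [Prod.addOrderOf, (hlev i hi).1]
    exact Nat.Coprime.lcm_eq_mul ((hcop.coprime_dvd_left (hfst _)).pow_right _)
  let A : ℕ → ℕ → Finset ι := fun l d => s.filter fun i => lev i = l ∧ addOrderOf (g i).1 = d
  have hAinv : ∀ l d, ∀ i ∈ A l d, invOrder (g i) = ((p : ℝ) ^ l)⁻¹ * (d : ℝ)⁻¹ := by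
    intro l d i hi
    obtain ⟨his, hil, hid⟩ := mem_filter.1 hi
    rw [invOrder, hord i his, hil, hid]
    push_cast
    rw [mul_inv, mul_comm]
  -- For `l ≥ 1` and `d ≥ 1`, at most `p` terms have order `p ^ l * d`.
  have hsmall : ∀ l d, 1 ≤ l → 0 < d → (A l d).card ≤ p := by
    intro l d hl hd
    refine h.card_le_of_reduced hred hp
      ((nsmulAddMonoidHom (α := C) (p ^ (l - 1))).comp (AddMonoidHom.snd G C)) _ hC
      (filter_subset _ _) (fun i hi => ?_) (fun i hi h0 => ?_) (d := p ^ (l - 1) * d)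
      (Nat.mul_pos (pow_pos hp.pos _) hd) (fun i hi => ?_) (fun T hT h0 => ?_)
    · obtain ⟨his, hil, hid⟩ := mem_filter.1 hi
      rw [AddMonoidHom.mem_ker, AddMonoidHom.comp_apply, nsmulAddMonoidHom_apply,
        nsmulAddMonoidHom_apply, ← mul_nsmul, ← pow_succ, Nat.sub_add_cancel hl, ← hil,
        ← (hlev i his).1]
      exact addOrderOf_nsmul_eq_zero _
    · obtain ⟨his, hil, hid⟩ := mem_filter.1 hi
      have := addOrderOf_dvd_of_nsmul_eq_zero (x := (g i).2) (n := p ^ (l - 1)) h0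
      rw [(hlev i his).1, hil, Nat.pow_dvd_pow_iff_le_right hp.one_lt] at this
      omega
    · obtain ⟨his, hil, hid⟩ := mem_filter.1 hi
      rw [hord i his, hil, hid, ← mul_assoc, ← pow_succ', Nat.sub_add_cancel hl, mul_comm]
    · have h1 : d • (∑ i ∈ T, g i).1 = 0 := by
        rw [Prod.fst_sum, smul_sum]
        refine sum_eq_zero fun i hi => ?_
        rw [← (mem_filter.1 (hT hi)).2.2]
        exact addOrderOf_nsmul_eq_zero _
      refine Prod.ext ?_ ?_
      · rw [Prod.smul_fst, mul_comm, mul_nsmul, h1, smul_zero]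
        rfl
      · rw [Prod.smul_snd, mul_nsmul]
        change d • _ = (0 : C)
        have h0 : p ^ (l - 1) • (∑ i ∈ T, g i).2 = 0 := h0
        rw [h0, smul_zero]
  -- All terms at level `l`: the divisors `d > 1` of `E` contribute little by `hwide`.
  have hlevel : ∀ l, 1 ≤ l → ∑ i ∈ s with lev i = l, invOrder (g i) ≤
      ((p : ℝ) ^ l)⁻¹ * ((A l 1).card + 2 * (p - 1) / p) := by
    intro l hl
    have h1 : ∑ i ∈ s with lev i = l, invOrder (g i) =
        ∑ d ∈ E.divisors, ((p : ℝ) ^ l)⁻¹ * ((A l d).card * (d : ℝ)⁻¹) := by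
      rw [← sum_fiberwise_of_maps_to (t := E.divisors) (g := fun i => addOrderOf (g i).1)
        (fun i _ => Nat.mem_divisors.2 ⟨hfst _, hE.ne'⟩)]
      refine sum_congr rfl fun d _ => ?_
      rw [filter_filter, sum_congr rfl (hAinv l d), sum_const, nsmul_eq_mul]
      ring
    rw [h1, ← mul_sum]
    refine mul_le_mul_of_nonneg_left ?_ (by positivity)
    have hone : 1 ∈ E.divisors := Nat.one_mem_divisors.2 hE.ne'
    rw [← add_sum_erase _ _ hone] at hwide ⊢
    rw [Nat.cast_one, inv_one] at hwide ⊢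
    rw [mul_one]
    have h2 : ∑ d ∈ E.divisors.erase 1, ((A l d).card : ℝ) * (d : ℝ)⁻¹ ≤
        p * ∑ d ∈ E.divisors.erase 1, (d : ℝ)⁻¹ := by
      rw [mul_sum]
      refine sum_le_sum fun d hd => mul_le_mul_of_nonneg_right ?_ (by positivity)
      exact_mod_cast hsmall l d hl (Nat.pos_of_mem_divisors (mem_of_mem_erase hd))
    have h3 : (p : ℝ) * ∑ d ∈ E.divisors.erase 1, (d : ℝ)⁻¹ ≤
        p * (2 * (p - 1) / (p : ℝ) ^ 2) := by
      gcongr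
      linarith
    have h4 : (p : ℝ) * (2 * (p - 1) / (p : ℝ) ^ 2) = 2 * (p - 1) / p := by
      field_simp
    linarith
  by_cases hall : ∀ l, 1 ≤ l → l ≤ α → p ≤ (A l 1).card + 1
  · -- The terms with trivial first component cover all elements of `C` killed by `p ^ α`, so the
    -- other terms descend to `G`, where their orders can only drop.
    have hAP : ∀ l, ((s.filter fun i => (g i).1 = 0).filter fun i => lev i = l) = A l 1 := by
      intro l
      ext i
      simp only [A, mem_filter, AddMonoid.addOrderOf_eq_one_iff]
      tauto
    have hq := h.quotient (AddMonoidHom.fst G C) (fun U hU hU0 => by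
      obtain ⟨V, hV, -, hVsum⟩ := exists_subset_sum_of_levels (s := s.filter fun i => (g i).1 = 0)
        hp hC (fun i => (g i).2) lev α (fun i hi => (hlev i (mem_filter.1 hi).1).1)
        (fun l h1 h2 => by rw [hAP]; exact hall l h1 h2) (-(∑ i ∈ U, g i).2) (by
          rw [smul_neg, neg_eq_zero, ← hmemM]
          exact (M α).sum_mem fun i hi => hM i (hU hi))
      refine ⟨V, hV, Prod.ext ?_ ?_⟩
      · rw [Prod.fst_sum, Prod.fst_neg, Prod.fst_sum]
        simp only [AddMonoidHom.coe_fst] at hU0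
        rw [hU0, neg_zero]
        exact sum_eq_zero fun i hi => (mem_filter.1 (hV hi)).2
      · rw [Prod.snd_sum, Prod.snd_neg, hVsum])
    have h1 : ∑ i ∈ s with ¬ (g i).1 = 0, invOrder (g i).1 ≤ B := by
      convert hG _ _ hq <;> rfl
    have h2 : ∑ i ∈ s with ¬ (g i).1 = 0, invOrder (g i) ≤
        ∑ i ∈ s with ¬ (g i).1 = 0, invOrder (g i).1 := by
      refine sum_le_sum fun i hi => ?_
      refine invOrder_le_of_dvd (Nat.pos_of_dvd_of_pos (hfst _) hE) ?_
      rw [hord i (mem_filter.1 hi).1]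
      exact dvd_mul_right _ _
    have h3 : ∑ i ∈ s with (g i).1 = 0, invOrder (g i) ≤
        ∑ l ∈ Ico (0 + 1) (α + 1), ((p : ℝ) ^ l)⁻¹ * p := by
      rw [← sum_fiberwise_of_maps_to (t := Ico (0 + 1) (α + 1)) (g := lev)
        (fun i hi => by
          obtain ⟨his, hi0⟩ := mem_filter.1 hi
          have h4 := hlev i his
          rw [mem_Ico]
          have : lev i ≠ 0 := by
            intro h5
            rw [h5, pow_zero, AddMonoid.addOrderOf_eq_one_iff] at h4
            exact h.ne_zero i his (Prod.ext hi0 h4.1)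
          omega)]
      refine sum_le_sum fun l hl => ?_
      rw [hAP, sum_congr rfl (hAinv l 1), sum_const, nsmul_eq_mul, Nat.cast_one, inv_one, mul_one,
        mul_comm]
      refine mul_le_mul_of_nonneg_left ?_ (by positivity)
      exact_mod_cast hsmall l 1 (mem_Ico.1 hl).1 one_pos
    have h4 := sum_Ico_inv_pow hp.pos (Nat.zero_le α)
    rw [range_zero, sum_empty, add_zero] at h4
    rw [← sum_filter_add_sum_filter_not s (fun i => (g i).1 = 0)]
    linarith
  · -- Some level `k + 1` has at most `p - 2` terms of order `p ^ (k + 1)`. All levels above `k` are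
    -- merged into one term, and the induction hypothesis applies to the resulting family.
    obtain ⟨k, ⟨hkα, hk⟩, hmax⟩ : ∃ k, (k < α ∧ (A (k + 1) 1).card + 2 ≤ p) ∧
        ∀ l, k + 1 < l → l ≤ α → (A l 1).card ≤ p := by
      push Not at hall
      obtain ⟨l, hl1, hlα, hl⟩ := hall
      refine ⟨l - 1, ⟨by omega, ?_⟩, fun l' h1 _ => hsmall l' 1 (by omega) one_pos⟩
      rw [Nat.sub_add_cancel hl1]
      omega
    obtain ⟨s', g', h', hM', hle⟩ := h.collapse (A := s.filter fun i => k + 1 ≤ lev i)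
      (filter_subset _ _) (M k) (fun i hi => by
        rw [mem_sdiff, mem_filter] at hi
        rw [hmemM]
        have h1 := hlev i hi.1
        refine addOrderOf_dvd_iff_nsmul_eq_zero.1 ?_
        rw [h1.1]
        have h2 : ¬ k + 1 ≤ lev i := fun hh => hi.2 ⟨hi.1, hh⟩
        exact pow_dvd_pow _ (by omega)) invOrder invOrder_nonneg
    have h1 := ih k hkα s' g' h' (fun i hi => (hmemM _ _).1 (hM' i hi))
    have h2 : ∑ i ∈ s with k + 1 ≤ lev i, invOrder (g i) ≤
        ∑ l ∈ Ico (k + 1) (α + 1), ((p : ℝ) ^ l)⁻¹ * ((A l 1).card + 2 * (p - 1) / p) := by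
      rw [← sum_fiberwise_of_maps_to (t := Ico (k + 1) (α + 1)) (g := lev)
        (fun i hi => by
          obtain ⟨his, hi0⟩ := mem_filter.1 hi
          have h4 := hlev i his
          rw [mem_Ico]
          omega)]
      refine sum_le_sum fun l hl => ?_
      rw [mem_Ico] at hl
      refine le_trans (le_of_eq (sum_congr ?_ fun _ _ => rfl)) (hlevel l (by omega))
      ext i
      simp only [mem_filter]
      constructor
      · tauto
      · rintro ⟨h1, h2⟩
        exact ⟨⟨h1, by omega⟩, h2⟩
    have h3 := sum_Ico_inv_pow_mul_le hp.pos hkα (fun l => ((A l 1).card : ℝ))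
      (by
        have : ((A (k + 1) 1).card : ℝ) + 2 ≤ p := by exact_mod_cast hk
        linarith)
      (fun l h1 h2 => by exact_mod_cast hmax l h1 h2)
    have h4 := sum_Ico_inv_pow hp.pos hkα.le
    have h5 : 0 ≤ 2 / (p : ℝ) * ((p : ℝ) ^ α)⁻¹ := by positivity
    rw [← sum_sdiff (filter_subset (fun i => k + 1 ≤ lev i) s)]
    linarith

end Levels

theorem IsUniquelyZeroSum.of_comp_injective {ι G H : Type*} [DecidableEq ι] [AddCommGroup G]
    [AddCommGroup H] {s : Finset ι} {g : ι → G} (π : G →+ H) (hπ : Function.Injective π)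
    (h : IsUniquelyZeroSum s fun i => π (g i)) : IsUniquelyZeroSum s g := by
  have key : ∀ t, ∑ i ∈ t, π (g i) = 0 ↔ ∑ i ∈ t, g i = 0 := fun t => by
    rw [← map_sum, map_eq_zero_iff π hπ]
  refine ⟨fun i hi h0 => h.ne_zero i hi (by rw [h0, map_zero]), (key s).1 h.sum_eq_zero,
    fun t ht u hu h1 h2 => (key _).1 (h.sum_inter t ht u hu ((key t).2 h1) ((key u).2 h2))⟩

/-- The groups `C_{p ^ m} ⊕ C_p`. In a merge-reduced family each order `p ^ l` with `l ≥ 2` occurs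
at most `p` times; merging all these terms leaves a family in the `p`-torsion, a plane over
`ZMod p`, where `IsUniquelyZeroSum.card_le_two_mul` applies. -/
theorem CrossNumberBound.cyclic_prod_prime {C : Type*} [AddCommGroup C] {p m : ℕ} [Fact p.Prime]
    (hC : Nat.card (nsmulAddMonoidHom (α := C) p).ker = p) (hm : 1 ≤ m)
    (hCm : ∀ x : C, p ^ m • x = 0) :
    CrossNumberBound (C × ZMod p) (1 + ∑ j ∈ range m, ((p : ℝ) ^ j)⁻¹) := by
  have hp : p.Prime := Fact.out
  have hp0 : (0 : ℝ) < p := by exact_mod_cast hp.pos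
  intro ι _ s g h
  refine IsUniquelyZeroSum.sum_invOrder_le_of_reduced ⊤ _ (fun s g h _ hred => ?_) s g h
    (fun i hi => AddSubgroup.mem_top _)
  have hZ : ∀ (k : ℕ) (y : ZMod p), 1 ≤ k → p ^ k • y = 0 := by
    intro k y hk
    rw [nsmul_eq_mul, Nat.cast_pow, ZMod.natCast_self, zero_pow (by omega), zero_mul]
  let lev : ι → ℕ := fun i => Nat.log p (addOrderOf (g i))
  have hlev : ∀ i, addOrderOf (g i) = p ^ lev i ∧ lev i ≤ m := by
    intro i
    obtain ⟨l, hl, hord⟩ := (Nat.dvd_prime_pow hp).1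
      (addOrderOf_dvd_of_nsmul_eq_zero (x := g i) (n := p ^ m)
        (Prod.ext (hCm _) (hZ m _ hm)))
    have : lev i = l := by simp only [lev, hord, Nat.log_pow hp.one_lt]
    rw [this]
    exact ⟨hord, hl⟩
  have hsmall : ∀ l, 2 ≤ l → (s.filter fun i => lev i = l).card ≤ p := by
    intro l hl
    refine h.card_le_of_reduced hred hp
      ((nsmulAddMonoidHom (α := C) (p ^ (l - 1))).comp (AddMonoidHom.fst C (ZMod p))) _ hC
      (filter_subset _ _) (fun i hi => ?_) (fun i hi h0 => ?_) (d := p ^ (l - 1))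
      (pow_pos hp.pos _) (fun i hi => ?_) (fun T hT h0 => ?_)
    · obtain ⟨his, hil⟩ := mem_filter.1 hi
      rw [AddMonoidHom.mem_ker, AddMonoidHom.comp_apply, nsmulAddMonoidHom_apply,
        nsmulAddMonoidHom_apply, ← mul_nsmul, ← pow_succ, Nat.sub_add_cancel (by omega), ← hil,
        ← (hlev i).1]
      exact congrArg Prod.fst (addOrderOf_nsmul_eq_zero (g i))
    · obtain ⟨his, hil⟩ := mem_filter.1 hi
      have := addOrderOf_dvd_of_nsmul_eq_zero (x := g i) (n := p ^ (l - 1))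
        (Prod.ext h0 (hZ (l - 1) _ (by omega)))
      rw [(hlev i).1, hil, Nat.pow_dvd_pow_iff_le_right hp.one_lt] at this
      omega
    · rw [(hlev i).1, (mem_filter.1 hi).2, ← pow_succ', Nat.sub_add_cancel (by omega)]
    · exact Prod.ext h0 (hZ (l - 1) _ (by omega))
  -- The merged family lies in the `p`-torsion.
  obtain ⟨s', g', h', hM', hle⟩ := h.collapse (A := s.filter fun i => 2 ≤ lev i)
    (filter_subset _ _) (nsmulAddMonoidHom (α := C × ZMod p) p).ker (fun i hi => by
      rw [mem_sdiff, mem_filter] at hi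
      rw [AddMonoidHom.mem_ker, nsmulAddMonoidHom_apply]
      refine addOrderOf_dvd_iff_nsmul_eq_zero.1 ?_
      rw [(hlev i).1]
      have h2 : ¬ 2 ≤ lev i := fun hh => hi.2 ⟨hi.1, hh⟩
      exact (pow_dvd_pow _ (show lev i ≤ 1 by omega)).trans (by rw [pow_one])) invOrder
      invOrder_nonneg
  have hM'' : ∀ i ∈ s', p • g' i = 0 := fun i hi => AddMonoidHom.mem_ker.1 (hM' i hi)
  have h1 : ∑ i ∈ s', invOrder (g' i) = s'.card * (p : ℝ)⁻¹ := by
    rw [← nsmul_eq_mul, ← sum_const]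
    refine sum_congr rfl fun i hi => ?_
    rw [invOrder, addOrderOf_eq_prime (hM'' i hi) (h'.ne_zero i hi)]
  have h2 : s'.card ≤ 2 * p := by
    classical
    let K := (nsmulAddMonoidHom (α := C) p).ker
    let φ : K ≃+ ZMod p := addEquivOfPrimeCardEq hC (Nat.card_zmod p)
    let g₀ : ι → K × ZMod p := fun i =>
      if hi : (g' i).1 ∈ K then (⟨(g' i).1, hi⟩, (g' i).2) else 0
    have hinj : Function.Injective (AddMonoidHom.prodMap K.subtype (AddMonoidHom.id (ZMod p))) :=
      Function.Injective.prodMap Subtype.val_injective Function.injective_id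
    have h3 : IsUniquelyZeroSum s' g₀ := by
      refine IsUniquelyZeroSum.of_comp_injective _ hinj (h'.congr fun i hi => ?_)
      have : (g' i).1 ∈ K := AddMonoidHom.mem_ker.2 (congrArg Prod.fst (hM'' i hi))
      simp only [g₀, dif_pos this]
      rfl
    exact (h3.map (AddEquiv.prodCongr φ (AddEquiv.refl (ZMod p))).toAddMonoidHom
      (fun t _ ht => (map_eq_zero_iff _ (AddEquiv.injective _)).1 ht)).card_le_two_mul
  have h3 : (s'.card : ℝ) * (p : ℝ)⁻¹ ≤ 2 := by
    rw [mul_inv_le_iff₀ hp0]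
    exact_mod_cast h2
  have h4 : ∑ i ∈ s with 2 ≤ lev i, invOrder (g i) ≤
      ∑ l ∈ Ico (1 + 1) (m + 1), ((p : ℝ) ^ l)⁻¹ * p := by
    rw [← sum_fiberwise_of_maps_to (t := Ico (1 + 1) (m + 1)) (g := lev)
      (fun i hi => by
        obtain ⟨his, hi0⟩ := mem_filter.1 hi
        have h4 := hlev i
        rw [mem_Ico]
        omega)]
    refine sum_le_sum fun l hl => ?_
    rw [mem_Ico] at hl
    have h5 : ∀ i ∈ (s.filter fun i => 2 ≤ lev i).filter fun i => lev i = l,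
        invOrder (g i) = ((p : ℝ) ^ l)⁻¹ := by
      intro i hi
      rw [invOrder, (hlev i).1, (mem_filter.1 hi).2]
      push_cast
      rfl
    rw [sum_congr rfl h5, sum_const, nsmul_eq_mul, mul_comm]
    refine mul_le_mul_of_nonneg_left ?_ (by positivity)
    have h6 : ((s.filter fun i => 2 ≤ lev i).filter fun i => lev i = l) ⊆
        s.filter fun i => lev i = l := filter_subset_filter _ (filter_subset _ _)
    exact_mod_cast (card_le_card h6).trans (hsmall l (by omega))
  have h5 := sum_Ico_inv_pow hp.pos hm
  rw [sum_range_one, pow_zero, inv_one] at h5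
  rw [← sum_sdiff (filter_subset (fun i => 2 ≤ lev i) s)]
  linarith

/-! ### Unique factorization of indexed sequences -/

namespace IndexedSeq

variable {G : Type*} [AddCommGroup G]

theorem sigma_add (S T : IndexedSeq G) : (S + T).sigma = S.sigma + T.sigma := by
  simp [sigma]

theorem factorizationProduct_add (Z W : FactorizationMonoid G) :
    factorizationProduct (Z + W) = factorizationProduct Z + factorizationProduct W := by
  simp [factorizationProduct]

theorem factorizationProduct_cons (T : {S : IndexedSeq G // S.IsIrreducible})
    (Z : FactorizationMonoid G) :
    factorizationProduct (T ::ₘ Z) = T.1 + factorizationProduct Z := by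
  simp [factorizationProduct]

theorem mem_factorizationProduct {Z : FactorizationMonoid G} {x : {g : G // g ≠ 0} × ℕ} :
    x ∈ factorizationProduct Z ↔ ∃ T ∈ Z, x ∈ T.1 := by
  have : factorizationProduct Z = (Z.map Subtype.val).join := rfl
  rw [this, Multiset.mem_join]
  simp

theorem le_factorizationProduct {Z : FactorizationMonoid G}
    {T : {S : IndexedSeq G // S.IsIrreducible}} (hT : T ∈ Z) : T.1 ≤ factorizationProduct Z := by
  obtain ⟨W, rfl⟩ := Multiset.exists_cons_of_mem hT
  rw [factorizationProduct_cons]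
  exact Multiset.le_add_right _ _

/-- Every zero-sum indexed sequence is a product of irreducible ones. -/
theorem exists_factorization (S : IndexedSeq G) (hS : S.sigma = 0) :
    ∃ Z : FactorizationMonoid G, factorizationProduct Z = S := by
  classical
  induction hn : S.card using Nat.strong_induction_on generalizing S with
  | _ n ih =>
    by_cases h0 : S = 0
    · exact ⟨0, by simp [factorizationProduct, h0]⟩
    · have hex : ∃ k, ∃ T : IndexedSeq G, T ≤ S ∧ T ≠ 0 ∧ T.sigma = 0 ∧ T.card = k :=
        ⟨_, S, le_rfl, h0, hS, rfl⟩
      obtain ⟨T, hTS, hT0, hTσ, hTk⟩ := Nat.find_spec hex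
      have hirr : T.IsIrreducible := by
        refine ⟨hT0, hTσ, fun U hUT hU0 hUσ => ?_⟩
        have := Nat.find_min' hex ⟨U, hUT.trans hTS, hU0, hUσ, rfl⟩
        exact Multiset.eq_of_le_of_card_le hUT (hTk ▸ this)
      have hadd : T + (S - T) = S := add_tsub_cancel_of_le hTS
      have hσ : (S - T).sigma = 0 := by
        rw [← hadd, sigma_add, hTσ, zero_add] at hS
        exact hS
      have hcard : (S - T).card < n := by
        have h1 := congrArg Multiset.card hadd
        rw [Multiset.card_add] at h1
        have := Multiset.card_pos.2 hT0
        omega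
      obtain ⟨Z, hZ⟩ := ih _ hcard (S - T) hσ rfl
      exact ⟨⟨T, hirr⟩ ::ₘ Z, by rw [factorizationProduct_cons, hZ, hadd]⟩

/-- Each zero-sum subset of a UFIS is a subproduct of the unique factorization, whose factors are
pairwise disjoint; so the intersection of two of them is the product of their common factors. -/
theorem IsUFIS.isUniquelyZeroSum [DecidableEq G] {s : Finset ({g : G // g ≠ 0} × ℕ)}
    (h : IsUFIS (s.val : IndexedSeq G)) : IsUniquelyZeroSum s fun x => (x.1 : G) := by
  classical
  obtain ⟨hnd, hσ, Z, hZ, huniq⟩ := h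
  have hfac : ∀ t ⊆ s, ∑ x ∈ t, (x.1 : G) = 0 → ∃ W ≤ Z, factorizationProduct W = t.val := by
    intro t ht h0
    have h1 : ∑ x ∈ s \ t, (x.1 : G) = 0 := by
      have h2 : ∑ x ∈ s, (x.1 : G) = 0 := hσ
      rwa [← sum_sdiff ht, h0, add_zero] at h2
    obtain ⟨W, hW⟩ := exists_factorization (t.val : IndexedSeq G) h0
    obtain ⟨W', hW'⟩ := exists_factorization ((s \ t).val : IndexedSeq G) h1
    have h3 : W + W' = Z := huniq _ (by
      change factorizationProduct (W + W') = s.val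
      rw [factorizationProduct_add, hW, hW']
      have := congrArg Finset.val (disjUnion_eq_union t (s \ t) disjoint_sdiff)
      rw [union_sdiff_of_subset ht] at this
      exact this)
    exact ⟨W, h3 ▸ Multiset.le_add_right _ _, hW⟩
  have hdisj : ∀ T ∈ Z, ∀ T' ∈ Z, ∀ x, x ∈ T.1 → x ∈ T'.1 → T = T' := by
    intro T hT T' hT' x hx hx'
    by_contra hne
    obtain ⟨W, rfl⟩ := Multiset.exists_cons_of_mem hT
    have hT'W : T' ∈ W := (Multiset.mem_cons.1 hT').resolve_left (Ne.symm hne)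
    have h1 : factorizationProduct (T ::ₘ W) = s.val := hZ
    rw [factorizationProduct_cons] at h1
    have h2 : Multiset.Nodup (T.1 + factorizationProduct W) := h1 ▸ s.nodup
    exact Multiset.disjoint_left.1 (Multiset.nodup_add.1 h2).2.2 hx
      (mem_factorizationProduct.2 ⟨T', hT'W, hx'⟩)
  refine ⟨fun x _ => x.1.2, hσ, fun t ht u hu h1 h2 => ?_⟩
  obtain ⟨W, hWZ, hW⟩ := hfac t ht h1
  obtain ⟨V, hVZ, hV⟩ := hfac u hu h2
  have hWV : factorizationProduct (W ∩ V) = (t ∩ u).val := by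
    have hnd' : (factorizationProduct (W ∩ V)).Nodup := by
      refine Multiset.nodup_of_le ?_ t.nodup
      obtain ⟨W', hW'⟩ := Multiset.le_iff_exists_add.1 (Multiset.inter_le_left (s := W) (t := V))
      conv_rhs => rw [← hW, hW', factorizationProduct_add]
      exact Multiset.le_add_right _ _
    refine (Multiset.Nodup.ext hnd' (t ∩ u).nodup).2 fun x => ?_
    rw [mem_factorizationProduct, Finset.mem_val, mem_inter, ← Finset.mem_val, ← Finset.mem_val,
      ← hW, ← hV, mem_factorizationProduct, mem_factorizationProduct]
    constructor
    · rintro ⟨T, hT, hx⟩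
      rw [Multiset.mem_inter] at hT
      exact ⟨⟨T, hT.1, hx⟩, ⟨T, hT.2, hx⟩⟩
    · rintro ⟨⟨T, hT, hx⟩, ⟨T', hT', hx'⟩⟩
      obtain rfl := hdisj T (Multiset.mem_of_le hWZ hT) T' (Multiset.mem_of_le hVZ hT') x hx hx'
      exact ⟨T, Multiset.mem_inter.2 ⟨hT, hT'⟩, hx⟩
  have h3 : ∀ Y : FactorizationMonoid G, (factorizationProduct Y).sigma = 0 := by
    intro Y
    induction Y using Multiset.induction_on with
    | empty => rfl
    | cons T Y ih => rw [factorizationProduct_cons, sigma_add, T.2.2.1, ih, add_zero]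
  have h4 := h3 (W ∩ V)
  rw [hWV] at h4
  exact h4

/-- If the zero-sum subsets are closed under intersection, two irreducible subsequences with a
common term are equal, so every factorization consists of all irreducible subsequences, once each.
-/
theorem isUFIS_of_isUniquelyZeroSum [DecidableEq G] {s : Finset ({g : G // g ≠ 0} × ℕ)}
    (h : IsUniquelyZeroSum s fun x => (x.1 : G)) : IsUFIS (s.val : IndexedSeq G) := by
  classical
  refine ⟨s.nodup, h.sum_eq_zero, ?_⟩
  obtain ⟨Z, hZ⟩ := exists_factorization (s.val : IndexedSeq G) h.sum_eq_zero
  have hmem : ∀ W : FactorizationMonoid G, factorizationProduct W = s.val →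
      ∀ T, T ∈ W ↔ T.1 ≤ s.val := by
    intro W hW T
    refine ⟨fun hT => hW ▸ le_factorizationProduct hT, fun hT => ?_⟩
    obtain ⟨x, hx⟩ := Multiset.exists_mem_of_ne_zero T.2.1
    have hxs : x ∈ factorizationProduct W := hW ▸ Multiset.mem_of_le hT hx
    obtain ⟨U, hU, hxU⟩ := mem_factorizationProduct.1 hxs
    have hUs : U.1 ≤ s.val := hW ▸ le_factorizationProduct hU
    let t : Finset ({g : G // g ≠ 0} × ℕ) := ⟨T.1, Multiset.nodup_of_le hT s.nodup⟩
    let u : Finset ({g : G // g ≠ 0} × ℕ) := ⟨U.1, Multiset.nodup_of_le hUs s.nodup⟩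
    have h0 := h.sum_inter t (Finset.val_le_iff.1 hT) u (Finset.val_le_iff.1 hUs) T.2.2.1 U.2.2.1
    have hne : (t ∩ u).val ≠ 0 := by
      intro h1
      have h2 : x ∈ (t ∩ u).val := by
        rw [Finset.mem_val]
        exact mem_inter.2 ⟨hx, hxU⟩
      rw [h1] at h2
      exact Multiset.notMem_zero x h2
    have h1 := T.2.2.2 (t ∩ u).val (Finset.val_le_iff.2 inter_subset_left) hne h0
    have h2 := U.2.2.2 (t ∩ u).val (Finset.val_le_iff.2 inter_subset_right) hne h0
    rwa [Subtype.ext (h1.symm.trans h2)]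
  have hnd : ∀ W : FactorizationMonoid G, factorizationProduct W = s.val → W.Nodup := by
    intro W hW
    rw [Multiset.nodup_iff_le]
    intro T hT
    obtain ⟨V, rfl⟩ := Multiset.le_iff_exists_add.1 hT
    rw [factorizationProduct_add, factorizationProduct_cons] at hW
    obtain ⟨x, hx⟩ := Multiset.exists_mem_of_ne_zero T.2.1
    have h2 : Multiset.Nodup (T.1 + factorizationProduct {T} + factorizationProduct V) :=
      hW ▸ s.nodup
    exact Multiset.disjoint_left.1 (Multiset.nodup_add.1 (Multiset.nodup_add.1 h2).1).2.2 hx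
      (mem_factorizationProduct.2 ⟨T, Multiset.mem_singleton_self T, hx⟩)
  refine ⟨Z, hZ, fun W hW => ?_⟩
  exact (Multiset.Nodup.ext (hnd W hW) (hnd Z hZ)).2 fun T => by
    rw [hmem W hW, hmem Z hZ]

theorem crossNumber_val (s : Finset ({g : G // g ≠ 0} × ℕ)) :
    crossNumber (s.val : IndexedSeq G) = ∑ x ∈ s, invOrder (x.1 : G) := by
  unfold crossNumber invOrder
  simp only [one_div]
  rfl

end IndexedSeq

/-- A uniquely zero-sum family over an arbitrary index type becomes a UFIS with the same cross
number when its indices are numbered. -/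
theorem IsUniquelyZeroSum.mem_ufisCrossNumbers {ι G : Type*} [DecidableEq ι] [AddCommGroup G]
    {s : Finset ι} {g : ι → G} (h : IsUniquelyZeroSum s g) :
    ∑ i ∈ s, invOrder (g i) ∈ ufisCrossNumbers G := by
  classical
  rcases s.eq_empty_or_nonempty with rfl | ⟨a, ha⟩
  · refine ⟨((∅ : Finset ({g : G // g ≠ 0} × ℕ)).val : IndexedSeq G),
      IndexedSeq.isUFIS_of_isUniquelyZeroSum ⟨by simp, by simp, fun t ht u hu _ _ => ?_⟩, ?_⟩
    · rw [subset_empty.1 ht, empty_inter, sum_empty]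
    · rw [IndexedSeq.crossNumber_val, sum_empty, sum_empty]
  let f : ι → {g : G // g ≠ 0} × ℕ := fun i =>
    if hi : i ∈ s then (⟨g i, h.ne_zero i hi⟩, s.equivFin ⟨i, hi⟩) else (⟨g a, h.ne_zero a ha⟩, 0)
  have hf : ∀ i ∈ s, ((f i).1 : G) = g i := fun i hi => by simp [f, hi]
  have hinj : ∀ i ∈ s, ∀ j ∈ s, f i = f j → i = j := by
    intro i hi j hj hij
    have h1 := congrArg Prod.snd hij
    simp only [f, hi, hj, dif_pos] at h1
    simpa using s.equivFin.injective (Fin.ext h1)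
  have hfib : ∀ j ∈ s, ∑ i ∈ s with f i = f j, g i = ((f j).1 : G) := by
    intro j hj
    rw [hf j hj, ← sum_singleton g j]
    refine sum_congr ?_ fun _ _ => rfl
    ext i
    simp only [mem_filter, mem_singleton]
    exact ⟨fun hi => hinj i hi.1 j hj hi.2, fun hi => by subst hi; exact ⟨hj, rfl⟩⟩
  have h1 : IsUniquelyZeroSum (s.image f) fun x => (x.1 : G) := by
    refine (h.fiber f fun x hx => ?_).congr fun x hx => ?_
    · obtain ⟨j, hj, rfl⟩ := mem_image.1 hx
      rw [hfib j hj]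
      exact (f j).1.2
    · obtain ⟨j, hj, rfl⟩ := mem_image.1 hx
      rw [hfib j hj]
  refine ⟨(s.image f).val, IndexedSeq.isUFIS_of_isUniquelyZeroSum h1, ?_⟩
  rw [IndexedSeq.crossNumber_val, sum_image hinj]
  exact sum_congr rfl fun i hi => by rw [hf i hi]

theorem CrossNumberBound.isGreatest {G : Type} [AddCommGroup G] {B : ℝ}
    (h : CrossNumberBound G B) (hB : B ∈ ufisCrossNumbers G) :
    IsGreatest (ufisCrossNumbers G) B := by
  classical
  refine ⟨hB, ?_⟩
  rintro x ⟨S, hS, rfl⟩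
  have : S = (⟨S, hS.1⟩ : Finset ({g : G // g ≠ 0} × ℕ)).val := rfl
  rw [this] at hS ⊢
  rw [IndexedSeq.crossNumber_val]
  exact h _ _ _ hS.isUniquelyZeroSum

/-! ### Families attaining the bound -/

theorem invOrder_map {G H : Type*} [AddCommGroup G] [AddCommGroup H] (f : G →+ H)
    (hf : Function.Injective f) (x : G) : invOrder (f x) = invOrder x := by
  rw [invOrder, invOrder, addOrderOf_injective f hf]

/-- The disjoint union of uniquely zero-sum families over the factors of a finite product is one
over the product. -/
theorem IsUniquelyZeroSum.pi {ι : Type*} [Fintype ι] [DecidableEq ι] {κ H : ι → Type*}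
    [∀ i, Fintype (κ i)] [∀ i, DecidableEq (κ i)] [∀ i, AddCommGroup (H i)]
    (g : ∀ i, κ i → H i) (h : ∀ i, IsUniquelyZeroSum univ (g i)) :
    IsUniquelyZeroSum (univ : Finset (Σ i, κ i)) fun x => Pi.single x.1 (g x.1 x.2) := by
  have key : ∀ (t : Finset (Σ i, κ i)) (i : ι), (∑ x ∈ t, Pi.single x.1 (g x.1 x.2) : ∀ i, H i) i =
      ∑ k with ⟨i, k⟩ ∈ t, g i k := by
    intro t i
    have ht : t = univ.sigma fun i => univ.filter fun k => (⟨i, k⟩ : Σ i, κ i) ∈ t := by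
      ext ⟨i, k⟩
      simp
    conv_lhs => rw [ht, sum_sigma, Finset.sum_apply]
    rw [sum_eq_single_of_mem i (mem_univ i)]
    · rw [Finset.sum_apply]
      exact sum_congr rfl fun k _ => Pi.single_eq_same _ _
    · intro j _ hji
      rw [Finset.sum_apply]
      exact Finset.sum_eq_zero fun k _ => Pi.single_eq_of_ne (Ne.symm hji) _
  refine ⟨fun x _ h0 => (h x.1).ne_zero x.2 (mem_univ _) ?_, ?_, fun t _ u _ h1 h2 => ?_⟩
  · rw [← Pi.single_eq_same (M := H) x.1 (g x.1 x.2), h0]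
    rfl
  · funext i
    rw [key]
    simpa using (h i).sum_eq_zero
  · funext i
    have h1 := congrFun h1 i
    have h2 := congrFun h2 i
    rw [key] at h1 h2 ⊢
    have h3 := (h i).sum_inter _ (subset_univ _) _ (subset_univ _) h1 h2
    rw [Pi.zero_apply, ← h3]
    refine sum_congr ?_ fun _ _ => rfl
    ext k
    simp

section PrimePower

variable {p a : ℕ}

/-- A family over `ZMod (p ^ a)` consisting of `a` blocks of `p` terms. The block `k < a` consists
of `p - 1` copies of `c = p ^ (a - 1 - k)` and one copy of `c - p * c`; its terms have order
`p ^ (k + 1)` and its sum is zero. -/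
def primePowerBlocks (p a : ℕ) (x : Fin a × Fin p) : ZMod (p ^ a) :=
  if x.2.val = 0 then (p : ZMod (p ^ a)) ^ (a - 1 - x.1) - (p : ZMod (p ^ a)) ^ (a - x.1)
  else (p : ZMod (p ^ a)) ^ (a - 1 - x.1)

theorem natCast_pow_eq_zero (p a : ℕ) : (p : ZMod (p ^ a)) ^ a = 0 := by
  rw [← Nat.cast_pow, ZMod.natCast_self]

theorem natCast_pow_pred_ne_zero (hp : p.Prime) (ha : 0 < a) :
    (p : ZMod (p ^ a)) ^ (a - 1) ≠ 0 := by
  rw [← Nat.cast_pow, Ne, ZMod.natCast_eq_zero_iff, Nat.pow_dvd_pow_iff_le_right hp.one_lt]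
  omega

theorem pow_nsmul_primePowerBlocks (x : Fin a × Fin p) :
    p ^ (x.1 : ℕ) • primePowerBlocks p a x = (p : ZMod (p ^ a)) ^ (a - 1) := by
  have h1 : (x.1 : ℕ) + (a - 1 - x.1) = a - 1 := by omega
  have h2 : (x.1 : ℕ) + (a - x.1) = a := by omega
  unfold primePowerBlocks
  rw [nsmul_eq_mul, Nat.cast_pow]
  split_ifs
  · rw [mul_sub, ← pow_add, ← pow_add, h1, h2, natCast_pow_eq_zero, sub_zero]
  · rw [← pow_add, h1]

theorem addOrderOf_primePowerBlocks (hp : p.Prime) (x : Fin a × Fin p) :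
    addOrderOf (primePowerBlocks p a x) = p ^ ((x.1 : ℕ) + 1) := by
  have : Fact p.Prime := ⟨hp⟩
  refine addOrderOf_eq_prime_pow ?_ ?_
  · rw [pow_nsmul_primePowerBlocks]
    exact natCast_pow_pred_ne_zero hp (by have := x.1.2; omega)
  · rw [pow_succ, mul_nsmul, pow_nsmul_primePowerBlocks, nsmul_eq_mul, ← pow_succ',
      Nat.sub_add_cancel (by have := x.1.2; omega), natCast_pow_eq_zero]

theorem filter_fst_eq (k : Fin a) :
    (univ.filter fun x : Fin a × Fin p => x.1 = k) = {k} ×ˢ univ := by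
  ext x
  rw [mem_filter, mem_product, mem_singleton]
  simp

theorem card_filter_fst_eq (k : Fin a) :
    (univ.filter fun x : Fin a × Fin p => x.1 = k).card = p := by
  rw [filter_fst_eq, card_product]
  simp

theorem sum_primePowerBlocks_block (hp : p.Prime) (k : Fin a) :
    ∑ x : Fin a × Fin p with x.1 = k, primePowerBlocks p a x = 0 := by
  rw [filter_fst_eq, sum_product, sum_singleton]
  have h2 : ∀ r : Fin p, primePowerBlocks p a (k, r) = (p : ZMod (p ^ a)) ^ (a - 1 - k) -
      if r = ⟨0, hp.pos⟩ then (p : ZMod (p ^ a)) ^ (a - k) else 0 := by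
    intro r
    simp only [primePowerBlocks, Fin.ext_iff]
    split_ifs <;> simp
  rw [sum_congr rfl fun r _ => h2 r, sum_sub_distrib, sum_const, sum_ite_eq' univ,
    if_pos (mem_univ _), card_univ, Fintype.card_fin, nsmul_eq_mul, ← pow_succ',
    show a - 1 - (k : ℕ) + 1 = a - k by have := k.2; omega, sub_self]

/-- A zero-sum subset contains each block entirely or not at all. Multiplication by `p ^ k` kills
the blocks below `k` and takes every term of the block `k` to the same element of order `p`; the
blocks above `k`, treated first, contribute zero. -/
theorem eq_empty_or_eq_block (hp : p.Prime) {t : Finset (Fin a × Fin p)}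
    (ht : ∑ x ∈ t, primePowerBlocks p a x = 0) (k : Fin a) :
    t.filter (fun x => x.1 = k) = ∅ ∨
      t.filter (fun x => x.1 = k) = univ.filter fun x => x.1 = k := by
  induction hn : a - (k : ℕ) using Nat.strong_induction_on generalizing k with
  | _ n ih =>
    have hfib : ∑ j : Fin a, ∑ x ∈ t with x.1 = j, p ^ (k : ℕ) • primePowerBlocks p a x = 0 := by
      rw [sum_fiberwise, ← smul_sum, ht, smul_zero]
    rw [sum_eq_single_of_mem k (mem_univ k)] at hfib
    · have h1 : ∀ x ∈ t.filter fun x => x.1 = k, p ^ (k : ℕ) • primePowerBlocks p a x =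
          (p : ZMod (p ^ a)) ^ (a - 1) := by
        intro x hx
        obtain rfl := (mem_filter.1 hx).2
        exact pow_nsmul_primePowerBlocks x
      rw [sum_congr rfl h1, sum_const, nsmul_eq_mul, ← Nat.cast_pow, ← Nat.cast_mul,
        ZMod.natCast_eq_zero_iff] at hfib
      have ha : a = (a - 1) + 1 := by have := k.2; omega
      have h2 : p ∣ (t.filter fun x => x.1 = k).card := by
        have h3 : p ^ (a - 1) * p ∣ p ^ (a - 1) * (t.filter fun x => x.1 = k).card := by
          rwa [← pow_succ, ← ha, mul_comm (p ^ (a - 1))]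
        exact (Nat.mul_dvd_mul_iff_left (pow_pos hp.pos _)).1 h3
      have hsub : t.filter (fun x => x.1 = k) ⊆ univ.filter fun x => x.1 = k :=
        filter_subset_filter _ (subset_univ t)
      rcases Nat.eq_zero_or_pos (t.filter fun x => x.1 = k).card with h0 | h0
      · exact Or.inl (card_eq_zero.1 h0)
      · refine Or.inr (eq_of_subset_of_card_le hsub ?_)
        rw [card_filter_fst_eq]
        exact Nat.le_of_dvd h0 h2
    · intro j _ hjk
      rcases lt_or_gt_of_ne hjk with h | h
      · refine Finset.sum_eq_zero fun x hx => ?_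
        obtain rfl := (mem_filter.1 hx).2
        refine addOrderOf_dvd_iff_nsmul_eq_zero.1 ?_
        rw [addOrderOf_primePowerBlocks hp]
        exact pow_dvd_pow _ h
      · rw [← smul_sum]
        rcases ih (a - j) (by have := j.2; have : (k : ℕ) < j := h; omega) j rfl with h1 | h1
        · rw [h1, sum_empty, smul_zero]
        · rw [h1, sum_primePowerBlocks_block hp, smul_zero]

theorem isUniquelyZeroSum_primePowerBlocks (hp : p.Prime) (a : ℕ) :
    IsUniquelyZeroSum univ (primePowerBlocks p a) := by
  refine ⟨fun x _ h0 => ?_, ?_, fun t _ u _ ht hu => ?_⟩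
  · have := addOrderOf_primePowerBlocks hp x
    rw [h0, addOrderOf_zero] at this
    have := Nat.one_lt_pow (show (x.1 : ℕ) + 1 ≠ 0 by omega) hp.one_lt
    omega
  · rw [← sum_fiberwise univ Prod.fst]
    exact Finset.sum_eq_zero fun k _ => sum_primePowerBlocks_block hp k
  · rw [← sum_fiberwise (t ∩ u) Prod.fst]
    refine Finset.sum_eq_zero fun k _ => ?_
    rw [filter_inter_distrib]
    rcases eq_empty_or_eq_block hp ht k with h1 | h1
    · rw [h1, empty_inter, sum_empty]
    · rcases eq_empty_or_eq_block hp hu k with h2 | h2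
      · rw [h2, inter_empty, sum_empty]
      · rw [h1, h2, inter_self, sum_primePowerBlocks_block hp]

theorem sum_invOrder_primePowerBlocks (hp : p.Prime) (a : ℕ) :
    ∑ x, invOrder (primePowerBlocks p a x) = ∑ k ∈ range a, ((p : ℝ) ^ k)⁻¹ := by
  have hp0 : (p : ℝ) ≠ 0 := by exact_mod_cast hp.ne_zero
  rw [← sum_fiberwise univ Prod.fst, Finset.sum_range]
  refine sum_congr rfl fun k _ => ?_
  have h1 : ∀ x ∈ univ.filter fun x : Fin a × Fin p => x.1 = k,
      invOrder (primePowerBlocks p a x) = ((p : ℝ) ^ ((k : ℕ) + 1))⁻¹ := by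
    intro x hx
    obtain rfl := (mem_filter.1 hx).2
    rw [invOrder, addOrderOf_primePowerBlocks hp]
    push_cast
    rfl
  rw [sum_congr rfl h1, sum_const, card_filter_fst_eq, nsmul_eq_mul, pow_succ]
  field_simp

end PrimePower

/-- The lower bound: the blocks of all cyclic summands together have cross number `K₁*(G)`. -/
theorem PrimePowerDecomposition.value_mem_ufisCrossNumbers {G : Type*} [AddCommGroup G]
    (D : PrimePowerDecomposition G) : D.value ∈ ufisCrossNumbers G := by
  classical
  have h := IsUniquelyZeroSum.pi (fun i => primePowerBlocks (D.p i) (D.a i))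
    fun i => isUniquelyZeroSum_primePowerBlocks (D.prime i) (D.a i)
  have h1 := (h.map D.equiv.symm.toAddMonoidHom
    fun t _ ht => (map_eq_zero_iff _ D.equiv.symm.injective).1 ht).mem_ufisCrossNumbers
  convert h1 using 1
  rw [value, ← univ_sigma_univ, sum_sigma]
  refine sum_congr rfl fun i _ => ?_
  rw [term_eq_geom (D.prime i) (D.pos i), ← sum_invOrder_primePowerBlocks (D.prime i)]
  refine sum_congr rfl fun k _ => ?_
  rw [invOrder_map _ D.equiv.symm.injective]
  exact (invOrder_map (AddMonoidHom.single (fun i => ZMod (D.p i ^ D.a i)) i)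
    (Pi.single_injective (M := fun i => ZMod (D.p i ^ D.a i)) i) _).symm

/-! ### The constant `K₁*` of products -/

namespace PrimePowerDecomposition

variable {G H : Type*} [AddCommGroup G] [AddCommGroup H]

/-- Transport of a decomposition along an isomorphism. -/
def congr (e : H ≃+ G) (D : PrimePowerDecomposition G) : PrimePowerDecomposition H where
  ι := D.ι
  fin := D.fin
  p := D.p
  a := D.a
  prime := D.prime
  pos := D.pos
  equiv := e.trans D.equiv

/-- The decomposition of a product obtained from decompositions of the factors. -/
def prod (D : PrimePowerDecomposition G) (E : PrimePowerDecomposition H) :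
    PrimePowerDecomposition (G × H) where
  ι := D.ι ⊕ E.ι
  fin := inferInstance
  p := Sum.elim D.p E.p
  a := Sum.elim D.a E.a
  prime := by rintro (i | i) <;> simp [D.prime, E.prime]
  pos := by rintro (i | i) <;> simp [D.pos, E.pos]
  equiv := (AddEquiv.prodCongr D.equiv E.equiv).trans
    { toEquiv := (Equiv.sumPiEquivProdPi fun i : D.ι ⊕ E.ι =>
        ZMod (Sum.elim D.p E.p i ^ Sum.elim D.a E.a i)).symm
      map_add' := by
        intro x y
        funext i
        rcases i with i | i <;> rfl }

theorem value_prod (D : PrimePowerDecomposition G) (E : PrimePowerDecomposition H) :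
    (D.prod E).value = D.value + E.value :=
  Fintype.sum_sum_type _

/-- The decomposition of a cyclic group of prime power order into one summand. -/
def zmodPow {p a : ℕ} (hp : p.Prime) (ha : 0 < a) : PrimePowerDecomposition (ZMod (p ^ a)) where
  ι := Unit
  fin := inferInstance
  p := fun _ => p
  a := fun _ => a
  prime := fun _ => hp
  pos := fun _ => ha
  equiv := (AddEquiv.piUnique fun _ : Unit => ZMod (p ^ a)).symm

theorem value_zmodPow {p a : ℕ} (hp : p.Prime) (ha : 0 < a) :
    (zmodPow hp ha).value = ∑ k ∈ range a, ((p : ℝ) ^ k)⁻¹ := by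
  rw [← term_eq_geom hp ha]
  exact Fintype.sum_unique (fun _ : Unit => ((p : ℝ) ^ a - 1) / ((p : ℝ) ^ a - (p : ℝ) ^ (a - 1)))

end PrimePowerDecomposition

section CrossK1Star

variable {G H : Type*} [AddCommGroup G] [AddCommGroup H] [Finite G] [Finite H]

theorem crossK1Star_congr (e : H ≃+ G) : crossK1Star H = crossK1Star G := by
  obtain ⟨D⟩ := PrimePowerDecomposition.exists_decomposition G
  rw [crossK1Star_eq_value D, crossK1Star_eq_value (D.congr e)]
  rfl

theorem crossK1Star_prod : crossK1Star (G × H) = crossK1Star G + crossK1Star H := by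
  obtain ⟨D⟩ := PrimePowerDecomposition.exists_decomposition G
  obtain ⟨E⟩ := PrimePowerDecomposition.exists_decomposition H
  rw [crossK1Star_eq_value D, crossK1Star_eq_value E, crossK1Star_eq_value (D.prod E),
    PrimePowerDecomposition.value_prod]

theorem crossK1Star_zmod_pow {p a : ℕ} [NeZero (p ^ a)] (hp : p.Prime) (ha : 0 < a) :
    crossK1Star (ZMod (p ^ a)) = ∑ k ∈ range a, ((p : ℝ) ^ k)⁻¹ := by
  rw [crossK1Star_eq_value (.zmodPow hp ha), PrimePowerDecomposition.value_zmodPow]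

theorem crossK1Star_zmod_prime {p : ℕ} [NeZero p] (hp : p.Prime) :
    crossK1Star (ZMod p) = 1 := by
  have : NeZero (p ^ 1) := ⟨by rw [pow_one]; exact hp.ne_zero⟩
  rw [← crossK1Star_congr (ZMod.ringEquivCongr (pow_one p)).toAddEquiv,
    crossK1Star_zmod_pow hp one_pos]
  simp

theorem crossK1Star_nonneg : 0 ≤ crossK1Star G := by
  obtain ⟨D⟩ := PrimePowerDecomposition.exists_decomposition G
  rw [crossK1Star_eq_value D]
  refine sum_nonneg fun i _ => ?_
  rw [PrimePowerDecomposition.term_eq_geom (D.prime i) (D.pos i)]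
  positivity

end CrossK1Star

theorem ZMod.card_ker_nsmul {p a : ℕ} [NeZero (p ^ a)] (ha : 0 < a) :
    Nat.card (nsmulAddMonoidHom (α := ZMod (p ^ a)) p).ker = p := by
  rw [IsAddCyclic.card_nsmulAddMonoidHom_ker, Nat.card_zmod]
  exact Nat.gcd_eq_right (dvd_pow_self p ha.ne')

theorem ZMod.self_nsmul_eq_zero (n : ℕ) (x : ZMod n) : n • x = 0 := by
  rw [nsmul_eq_mul, ZMod.natCast_self, zero_mul]

namespace CrossNumberBound

variable {G H : Type*} [AddCommGroup G] [AddCommGroup H] {B : ℝ}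

theorem congr (e : H ≃+ G) (h : CrossNumberBound G B) : CrossNumberBound H B := by
  intro ι _ s g hg
  have h1 := h ι s _ (hg.map e.toAddMonoidHom
    fun t _ ht => (map_eq_zero_iff _ e.injective).1 ht)
  exact (sum_congr rfl fun i _ => (invOrder_map e.toAddMonoidHom e.injective (g i)).symm).trans_le
    h1

theorem of_subsingleton [Subsingleton G] (hB : 0 ≤ B) : CrossNumberBound G B := by
  intro ι _ s g hg
  rw [sum_eq_zero fun i hi => absurd (Subsingleton.elim _ _) (hg.ne_zero i hi)]
  exact hB

theorem prod_zmod_pow {E : ℕ} (hE : 0 < E) (hGE : ∀ x : G, E • x = 0) {p a : ℕ} (hp : p.Prime)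
    (ha : 0 < a) (hcop : E.Coprime p)
    (hwide : ∑ d ∈ E.divisors, (d : ℝ)⁻¹ ≤ 1 + 2 * (p - 1) / (p : ℝ) ^ 2)
    (h : CrossNumberBound G B) :
    CrossNumberBound (G × ZMod (p ^ a)) (B + ∑ j ∈ range a, ((p : ℝ) ^ j)⁻¹) := by
  have : NeZero (p ^ a) := ⟨(pow_pos hp.pos a).ne'⟩
  intro ι _ s g hg
  exact sum_invOrder_le_of_prod_cyclic hE hGE hp hcop (ZMod.card_ker_nsmul ha) hwide
    (fun s g => h ι s g) a s g hg fun i _ => ZMod.self_nsmul_eq_zero _ _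

end CrossNumberBound

/-! ### 2-wide integers -/

/-- The product in the definition of 2-wide is the sum of the inverses of the divisors. -/
theorem prod_primeFactors_eq_sum_inv_divisors {n : ℕ} (hn : n ≠ 0) :
    ∏ q ∈ n.primeFactors, ((q : ℝ) ^ (n.factorization q + 1) - 1) /
      ((q : ℝ) ^ (n.factorization q + 1) - (q : ℝ) ^ n.factorization q) =
      ∑ d ∈ n.divisors, (d : ℝ)⁻¹ := by
  have h1 : ∑ d ∈ n.divisors, (d : ℝ)⁻¹ = (∑ d ∈ n.divisors, (d : ℝ)) / n := by
    rw [← Nat.sum_div_divisors n fun d => (d : ℝ)⁻¹, sum_div]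
    refine sum_congr rfl fun d hd => ?_
    have hd0 : (d : ℝ) ≠ 0 := by exact_mod_cast (Nat.pos_of_mem_divisors hd).ne'
    rw [Nat.cast_div (Nat.dvd_of_mem_divisors hd) hd0, inv_div]
  have h2 : (n : ℝ) = ∏ q ∈ n.primeFactors, (q : ℝ) ^ n.factorization q := by
    conv_lhs => rw [← Nat.prod_factorization_pow_eq_self hn]
    rw [Finsupp.prod, Nat.support_factorization]
    push_cast
    rfl
  rw [h1, ← Nat.cast_sum, Nat.sum_divisors hn, Nat.cast_prod]
  conv_rhs => rw [h2]
  rw [← prod_div_distrib]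
  refine prod_congr rfl fun q hq => ?_
  have hq' := Nat.prime_of_mem_primeFactors hq
  have hq0 : (q : ℝ) ≠ 0 := by exact_mod_cast hq'.ne_zero
  have h3 := PrimePowerDecomposition.term_eq_geom hq' (Nat.succ_pos (n.factorization q))
  simp only [Nat.succ_eq_add_one, Nat.add_sub_cancel] at h3
  rw [h3, Nat.cast_sum, sum_div, ← sum_range_reflect]
  refine sum_congr rfl fun k hk => ?_
  rw [mem_range] at hk
  have h4 : (q : ℝ) ^ n.factorization q = q ^ k * q ^ (n.factorization q + 1 - 1 - k) := by
    rw [← pow_add]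
    congr 1
    omega
  rw [h4]
  push_cast
  field_simp

/-- A 2-wide integer other than `1` splits off the power of its smallest prime, leaving a 2-wide
cofactor for which the 2-wide condition becomes a bound for the sum of the inverse divisors. -/
theorem TwoWide.exists_eq_pow_mul {n : ℕ} (hn : TwoWide n) (hn1 : n ≠ 1) :
    ∃ p a m : ℕ, p.Prime ∧ 0 < a ∧ n = p ^ a * m ∧ m.Coprime p ∧ TwoWide m ∧
      (∀ q ∈ m.primeFactors, p < q) ∧
      ∑ d ∈ m.divisors, (d : ℝ)⁻¹ ≤ 1 + 2 * (p - 1) / (p : ℝ) ^ 2 := by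
  obtain ⟨hpos, hw⟩ := hn
  have hp : n.minFac.Prime := Nat.minFac_prime hn1
  set p := n.minFac with hpdef
  set m := n / p ^ n.factorization p with hm
  have hmpos : 0 < m := Nat.ordCompl_pos p hpos.ne'
  have hfac : m.factorization = n.factorization.erase p := Nat.factorization_ordCompl n p
  have hmem : ∀ q ∈ m.primeFactors, q ∈ n.primeFactors ∧ p < q := by
    intro q hq
    have hqn : q ∣ n := (Nat.dvd_of_mem_primeFactors hq).trans (Nat.ordCompl_dvd n p)
    have hqp := Nat.prime_of_mem_primeFactors hq
    refine ⟨Nat.mem_primeFactors.2 ⟨hqp, hqn, hpos.ne'⟩, lt_of_le_of_ne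
      (Nat.minFac_le_of_dvd hqp.two_le hqn) ?_⟩
    intro hqe
    exact Nat.not_dvd_ordCompl hp hpos.ne' (by
      have h := Nat.dvd_of_mem_primeFactors hq
      rwa [← hqe] at h)
  have hmem' : ∀ q ∈ n.primeFactors, p < q → q ∈ m.primeFactors := by
    intro q hq hpq
    rw [← Nat.support_factorization, hfac, Finsupp.support_erase, mem_erase,
      Nat.support_factorization]
    exact ⟨hpq.ne', hq⟩
  have hfaceq : ∀ q, p < q → m.factorization q = n.factorization q := by
    intro q hpq
    rw [hfac, Finsupp.erase_ne hpq.ne']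
  have hfilt : ∀ r, p ≤ r → n.primeFactors.filter (r < ·) = m.primeFactors.filter (r < ·) := by
    intro r hr
    ext q
    simp only [mem_filter]
    exact ⟨fun h => ⟨hmem' q h.1 (hr.trans_lt h.2), h.2⟩, fun h => ⟨(hmem q h.1).1, h.2⟩⟩
  refine ⟨p, n.factorization p, m, hp, hp.factorization_pos_of_dvd hpos.ne' (Nat.minFac_dvd n),
    (Nat.ordProj_mul_ordCompl_eq_self n p).symm, (Nat.coprime_ordCompl hp hpos.ne').symm,
    ⟨hmpos, fun r hr ⟨q, hq, hrq⟩ => ?_⟩, fun q hq => (hmem q hq).2, ?_⟩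
  · obtain ⟨hrn, hpr⟩ := hmem r hr
    have h := hw r hrn ⟨q, (hmem q hq).1, hrq⟩
    rw [hfilt r hpr.le] at h
    rwa [prod_congr rfl fun q hq => by
      rw [hfaceq q (hpr.trans (mem_filter.1 hq).2)]]
  · have hp1 : (1 : ℝ) ≤ p := by exact_mod_cast hp.one_lt.le
    rcases m.primeFactors.eq_empty_or_nonempty with h0 | ⟨q, hq⟩
    · rw [Nat.primeFactors_eq_empty] at h0
      rw [h0.resolve_left hmpos.ne']
      have : 0 ≤ 2 * ((p : ℝ) - 1) / (p : ℝ) ^ 2 := by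
        have := sub_nonneg.2 hp1
        positivity
      simpa using this
    · obtain ⟨-, -, h⟩ := hw p (Nat.mem_primeFactors.2 ⟨hp, Nat.minFac_dvd n, hpos.ne'⟩)
        ⟨q, hmem q hq⟩
      have hall : m.primeFactors.filter (p < ·) = m.primeFactors :=
        filter_true_of_mem fun q hq => (hmem q hq).2
      have hprod : ∏ q ∈ n.primeFactors with p < q, q ^ n.factorization q = m := by
        rw [hfilt p le_rfl, hall]
        conv_rhs => rw [← Nat.prod_factorization_pow_eq_self hmpos.ne']
        rw [Finsupp.prod, Nat.support_factorization]
        exact prod_congr rfl fun q hq => by rw [hfaceq q (hmem q hq).2]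
      rw [hprod, prod_primeFactors_eq_sum_inv_divisors hmpos.ne'] at h
      refine h.trans (le_of_eq ?_)
      have hp0 : (p : ℝ) ≠ 0 := by positivity
      field_simp
      ring

/-! ### The upper bounds and the maxima -/

/-- The Chinese remainder isomorphism splitting off the `p`-part. -/
def ZMod.mulPowEquiv {p a m : ℕ} (h : m.Coprime p) :
    ZMod (p ^ a * m) ≃+ ZMod m × ZMod (p ^ a) :=
  ((ZMod.chineseRemainder (h.symm.pow_left a)).trans RingEquiv.prodComm).toAddEquiv

/-- The upper bound for `C_n`, starting from the trivial group and adding the primes in decreasing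
order. -/
theorem crossNumberBound_zmod (n : ℕ) [hn0 : NeZero n] (hn : TwoWide n) :
    CrossNumberBound (ZMod n) (crossK1Star (ZMod n)) := by
  induction n using Nat.strong_induction_on generalizing hn0 with
  | _ n ih =>
  by_cases hn1 : n = 1
  · subst hn1
    exact .of_subsingleton crossK1Star_nonneg
  obtain ⟨p, a, m, hp, ha, rfl, hcop, hm, -, hwide⟩ := hn.exists_eq_pow_mul hn1
  have : NeZero m := ⟨hm.1.ne'⟩
  have : NeZero (p ^ a) := ⟨(pow_pos hp.pos a).ne'⟩
  have hlt : m < p ^ a * m := lt_mul_of_one_lt_left hm.1 (Nat.one_lt_pow ha.ne' hp.one_lt)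
  rw [crossK1Star_congr (ZMod.mulPowEquiv hcop), crossK1Star_prod, crossK1Star_zmod_pow hp ha]
  exact ((ih m hlt hm).prod_zmod_pow hm.1 (ZMod.self_nsmul_eq_zero m) hp ha hcop hwide).congr
    (ZMod.mulPowEquiv hcop)

/-- The upper bound for `C_n ⊕ C_q`, starting from `C_{q ^ a} ⊕ C_q` and adding the smaller primes
in decreasing order. -/
theorem crossNumberBound_zmod_prod (n : ℕ) [hn0 : NeZero n] (hn : TwoWide n) (q : ℕ) [NeZero q]
    (hq : IsLargestPrimeFactor q n) :
    CrossNumberBound (ZMod n × ZMod q) (crossK1Star (ZMod n × ZMod q)) := by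
  induction n using Nat.strong_induction_on generalizing hn0 with
  | _ n ih =>
  obtain ⟨⟨hqp, hqn⟩, hmax⟩ := hq
  have hn1 : n ≠ 1 := by
    rintro rfl
    exact hqp.one_lt.ne' (Nat.dvd_one.1 hqn)
  obtain ⟨p, a, m, hp, ha, rfl, hcop, hm, hlarge, hwide⟩ := hn.exists_eq_pow_mul hn1
  have : NeZero m := ⟨hm.1.ne'⟩
  have : NeZero (p ^ a) := ⟨(pow_pos hp.pos a).ne'⟩
  have hpn : p ∣ p ^ a * m := (dvd_pow_self p ha.ne').mul_right m
  by_cases hm1 : m = 1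
  · -- Here `n` is a power of `p`, so `q = p`.
    subst hm1
    obtain rfl : q = p := by
      refine (Nat.prime_dvd_prime_iff_eq hqp hp).1 (hqp.dvd_of_dvd_pow (n := a) ?_)
      rwa [mul_one] at hqn
    have : Fact q.Prime := ⟨hqp⟩
    let e : ZMod (q ^ a * 1) × ZMod q ≃+ ZMod (q ^ a) × ZMod q :=
      AddEquiv.prodCongr (ZMod.ringEquivCongr (mul_one (q ^ a))).toAddEquiv (AddEquiv.refl _)
    rw [crossK1Star_congr e, crossK1Star_prod, crossK1Star_zmod_pow hqp ha,
      crossK1Star_zmod_prime hqp, add_comm]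
    exact (CrossNumberBound.cyclic_prod_prime (ZMod.card_ker_nsmul ha) ha
      (ZMod.self_nsmul_eq_zero _)).congr e
  · -- Here `q` divides the cofactor `m`, which is then an exponent of `C_m ⊕ C_q`.
    have hqm : q ∣ m := by
      refine (hqp.dvd_mul.1 hqn).resolve_left fun h => ?_
      obtain rfl := (Nat.prime_dvd_prime_iff_eq hqp hp).1 (hqp.dvd_of_dvd_pow h)
      obtain ⟨r, hr, hrm⟩ := Nat.exists_prime_and_dvd hm1
      exact absurd (hlarge r (Nat.mem_primeFactors.2 ⟨hr, hrm, hm.1.ne'⟩))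
        (hmax ⟨hr, hrm.mul_left _⟩).not_gt
    have hqm' : IsLargestPrimeFactor q m :=
      ⟨⟨hqp, hqm⟩, fun r hr => hmax ⟨hr.1, hr.2.mul_left _⟩⟩
    have hlt : m < p ^ a * m := lt_mul_of_one_lt_left hm.1 (Nat.one_lt_pow ha.ne' hp.one_lt)
    let e : ZMod (p ^ a * m) × ZMod q ≃+ (ZMod m × ZMod q) × ZMod (p ^ a) :=
      (AddEquiv.prodCongr (ZMod.mulPowEquiv hcop) (AddEquiv.refl _)).trans
        (AddEquiv.prodAssoc.trans
          ((AddEquiv.prodCongr (AddEquiv.refl _) AddEquiv.prodComm).trans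
            AddEquiv.prodAssoc.symm))
    rw [crossK1Star_congr e, crossK1Star_prod, crossK1Star_zmod_pow hp ha]
    refine ((ih m hlt hm hqm').prod_zmod_pow hm.1 (fun x => Prod.ext ?_ ?_) hp ha hcop hwide).congr
      e
    · exact ZMod.self_nsmul_eq_zero m x.1
    · rw [Prod.smul_snd, nsmul_eq_mul, (ZMod.natCast_eq_zero_iff m q).2 hqm, zero_mul]
      rfl

theorem CrossNumberBound.isGreatest_and_crossK1_eq {G : Type} [AddCommGroup G] [Finite G]
    (h : CrossNumberBound G (crossK1Star G)) :
    IsGreatest (ufisCrossNumbers G) (crossK1 G) ∧ crossK1 G = crossK1Star G := by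
  have h1 : IsGreatest (ufisCrossNumbers G) (crossK1Star G) :=
    h.isGreatest (PrimePowerDecomposition.value_mem_ufisCrossNumbers _)
  have h2 : crossK1 G = crossK1Star G := h1.csSup_eq
  exact ⟨h2 ▸ h1, h2⟩

theorem mainTheorem6 (n : ℕ) [NeZero n] (hn : TwoWide n) :
    (IsGreatest (ufisCrossNumbers (ZMod n)) (crossK1 (ZMod n)) ∧
      crossK1 (ZMod n) = crossK1Star (ZMod n)) ∧
    ∀ (q : ℕ) [NeZero q], IsLargestPrimeFactor q n →
      IsGreatest (ufisCrossNumbers (ZMod n × ZMod q)) (crossK1 (ZMod n × ZMod q)) ∧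
        crossK1 (ZMod n × ZMod q) = crossK1Star (ZMod n × ZMod q) :=
  ⟨(crossNumberBound_zmod n hn).isGreatest_and_crossK1_eq,
    fun q _ hq => (crossNumberBound_zmod_prod n hn q hq).isGreatest_and_crossK1_eq⟩
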